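/- Let $\mathbb H=\{(z_1,z_2)\in\mathbb C^2:|z_1|<|z_2|<1\}$ be the Hartogs triangle, $\mathbb D$ the open unit disc, $\mathbb D^*=\mathbb D\setminus\{0\}$, and let $\phi:\mathbb H\to\mathbb D\times\mathbb D^*$, $\phi(z_1,z_2)=(z_1/z_2,z_2)$, with inverse $\phi^{-1}(w_1,w_2)=(w_1w_2,w_2)$. For $s\in\mathbb R$ let $L^p_s(\mathbb H)$ be the $L^p$ space of the measure $|z_2|^s\,dV$ on $\mathbb H$, i.e. $\|g\|^p_{L^p_s(\mathbb H)}=\int_{\mathbb H}|g|^p|z_2|^s\,dV$. All derivatives below are taken in the weak (distributional) sense. For a $(0,1)$-form $f=f_1\,d\bar w_1+f_2\,d\bar w_2$ on $\mathbb D\times\mathbb D^*$ put $\mathscr D f=\frac12\big(\frac{\partial f_1}{\partial\bar w_2}+\frac{\partial f_2}{\partial\bar w_1}\big)$ and $$T(f)(w)=\frac{-1}{2\pi i}\int_{\mathbb D^*}\frac{f_2(w_1,\zeta_2)}{\zeta_2-w_2}\,d\bar\zeta_2\wedge d\zeta_2+\frac{-1}{2\pi i}\int_{\mathbb D}\frac{f_1(\zeta_1,w_2)}{\zeta_1-w_1}\,d\bar\zeta_1\wedge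 d\zeta_1+\frac{-1}{(2\pi i)^2}\int_{\mathbb D\times\mathbb D^*}\frac{\mathscr D f(\zeta_1,\zeta_2)}{(\zeta_1-w_1)(\zeta_2-w_2)}\,d\bar\zeta_1\wedge d\zeta_1\wedge d\bar\zeta_2\wedge d\zeta_2 ,$$ where $d\bar\zeta\wedge d\zeta=2i\,dA(\zeta)$ in each variable. **Theorem.** Let $1\le p<\infty$. There is a constant $C>0$, depending only on $p$, such that the following holds. Let $\alpha=\alpha_1\,d\bar z_1+\alpha_2\,d\bar z_2$ be a $(0,1)$-form on $\mathbb H$ that is $\bar\partial$-closed in the weak sense, and assume that 1. $\alpha_1,\alpha_2\in L^p_{-2}(\mathbb H)$; 2. $\partial\alpha_2/\partial\bar z_1=\partial\alpha_1/\partial\bar z_2\in L^p_{-1}(\mathbb H)$ and $\partial\alpha_1/\partial\bar z_1\in L^p_{-1}(\mathbb H)$. Let $f=(\phi^{-1})^*\alpha$, that is, $f_1=\bar w_2\cdot(\alpha_1\circ\phi^{-1})$ and $f_2=\bar w_1\cdot(\alpha_1\circ\phi^{-1})+\alpha_2\circ\phi^{-1}$. Then $f_1$, $f_2$ and $\mathscr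 D f$ belong to $L^p(\mathbb D\times\mathbb D^*)$, the integrals defining $T(f)(w)$ converge absolutely for almost every $w\in\mathbb D\times\mathbb D^*$, and $v=T(f)\circ\phi$ is a weak solution of $\bar\partial v=\alpha$ on $\mathbb H$ that satisfies $$\|v\|_{L^p(\mathbb H)}\le C\Big(\sum_{j=1}^2\|\alpha_j\|_{L^p_{-2}(\mathbb H)}+\sum_{j=1}^2\Big\|\frac{\partial\alpha_1}{\partial\bar z_j}\Big\|_{L^p_{-1}(\mathbb H)}\Big).$$ -/

import Mathlib

open MeasureTheory Complex
open scoped ENNReal NNReal ContDiff ComplexConjugate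

noncomputable section

namespace HartogsDbar

/-- The Hartogs triangle `{(z₁, z₂) : |z₁| < |z₂| < 1}`. -/
def hartogs : Set (ℂ × ℂ) := {z | ‖z.1‖ < ‖z.2‖ ∧ ‖z.2‖ < 1}

/-- The open unit disc. -/
def disc : Set ℂ := {z | ‖z‖ < 1}

/-- The punctured unit disc. -/
def puncDisc : Set ℂ := {z | 0 < ‖z‖ ∧ ‖z‖ < 1}

/-- A `(0,1)`-form `α₁ dz̄₁ + α₂ dz̄₂` in two complex variables, given by its coefficients:
`α 0` is the coefficient of `dz̄₁` and `α 1` is the coefficient of `dz̄₂`. Only the values on the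
domain under consideration are relevant. -/
abbrev Form01 : Type := Fin 2 → ℂ × ℂ → ℂ

/-- The coordinate vectors `(1, 0)` and `(0, 1)`. -/
def coordVec : Fin 2 → ℂ × ℂ := ![(1, 0), (0, 1)]

/-- The classical derivative `∂φ/∂z̄ⱼ = (∂φ/∂xⱼ + i ∂φ/∂yⱼ) / 2` of a (smooth) function; the index
`0` stands for the variable `z₁` and the index `1` for `z₂`. -/
def dbar (j : Fin 2) (φ : ℂ × ℂ → ℂ) (z : ℂ × ℂ) : ℂ :=
  (1 / 2) * (fderiv ℝ φ z (coordVec j) + I * fderiv ℝ φ z (I • coordVec j))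

/-- Test functions on `Ω`: complex valued, smooth in the real sense, with compact support
contained in `Ω`. -/
def IsTestFunction (Ω : Set (ℂ × ℂ)) (φ : ℂ × ℂ → ℂ) : Prop :=
  ContDiff ℝ ∞ φ ∧ HasCompactSupport φ ∧ tsupport φ ⊆ Ω

/-- `g = ∂u/∂z̄ⱼ` on the open set `Ω` in the weak (distributional) sense. -/
def HasWeakDbar (Ω : Set (ℂ × ℂ)) (j : Fin 2) (u g : ℂ × ℂ → ℂ) : Prop :=
  LocallyIntegrableOn u Ω ∧ LocallyIntegrableOn g Ω ∧
    ∀ φ, IsTestFunction Ω φ → ∫ z in Ω, u z * dbar j φ z = -∫ z in Ω, g z * φ z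

/-- `v` is a weak solution of `∂̄v = α` on `Ω`. -/
def IsWeakSolution (Ω : Set (ℂ × ℂ)) (v : ℂ × ℂ → ℂ) (α : Form01) : Prop :=
  ∀ j, HasWeakDbar Ω j v (α j)

/-- `α` is `∂̄`-closed on `Ω` in the weak sense: `∂α₁/∂z̄₂ = ∂α₂/∂z̄₁` as distributions. -/
def IsWeaklyDbarClosed (Ω : Set (ℂ × ℂ)) (α : Form01) : Prop :=
  (∀ j, LocallyIntegrableOn (α j) Ω) ∧
    ∀ φ, IsTestFunction Ω φ → ∫ z in Ω, α 0 z * dbar 1 φ z = ∫ z in Ω, α 1 z * dbar 0 φ z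

/-- The function `g` represents the distribution `𝒟f = (∂f₁/∂z̄₂ + ∂f₂/∂z̄₁) / 2` on `Ω`. -/
def IsScriptD (Ω : Set (ℂ × ℂ)) (f : Form01) (g : ℂ × ℂ → ℂ) : Prop :=
  (∀ j, LocallyIntegrableOn (f j) Ω) ∧ LocallyIntegrableOn g Ω ∧
    ∀ φ, IsTestFunction Ω φ →
      (1 / 2) * ((∫ z in Ω, f 0 z * dbar 1 φ z) + ∫ z in Ω, f 1 z * dbar 0 φ z)
        = -∫ z in Ω, g z * φ z

open Classical in
/-- `𝒟f` on `Ω`, as a function (determined almost everywhere on `Ω`); it has no meaning unless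
the distribution `𝒟f` is given by a locally integrable function. -/
def scriptD (Ω : Set (ℂ × ℂ)) (f : Form01) : ℂ × ℂ → ℂ :=
  if h : ∃ g, IsScriptD Ω f g then h.choose else 0

/-- `f ∈ 𝓑`: the coefficients of `f` are in `L^p(Ω)` and `𝒟f` is given by a function in `L^p(Ω)`. -/
def MemB (Ω : Set (ℂ × ℂ)) (p : ℝ≥0∞) (f : Form01) : Prop :=
  (∀ j, MemLp (f j) p (volume.restrict Ω)) ∧
    IsScriptD Ω f (scriptD Ω f) ∧ MemLp (scriptD Ω f) p (volume.restrict Ω)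

/-- The integral operator `T` on `𝔻 × 𝔻*`. In each variable `dζ̄ ∧ dζ = 2i dA(ζ)` with `dA` the
Lebesgue measure, which is the origin of the factors `2 * I`. -/
def T (f : Form01) (w : ℂ × ℂ) : ℂ :=
  (-1 / (2 * Real.pi * I)) * (∫ ζ in puncDisc, f 1 (w.1, ζ) / (ζ - w.2) * (2 * I))
  + (-1 / (2 * Real.pi * I)) * (∫ ζ in disc, f 0 (ζ, w.2) / (ζ - w.1) * (2 * I))
  + (-1 / (2 * Real.pi * I) ^ 2) *
      (∫ ζ in disc ×ˢ puncDisc,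
        scriptD (disc ×ˢ puncDisc) f ζ / ((ζ.1 - w.1) * (ζ.2 - w.2)) * ((2 * I) * (2 * I)))

/-- The three integrals that define `T f` converge absolutely at the point `w`. -/
def TConverges (f : Form01) (w : ℂ × ℂ) : Prop :=
  IntegrableOn (fun ζ => f 1 (w.1, ζ) / (ζ - w.2)) puncDisc ∧
  IntegrableOn (fun ζ => f 0 (ζ, w.2) / (ζ - w.1)) disc ∧
  IntegrableOn (fun ζ : ℂ × ℂ =>
    scriptD (disc ×ˢ puncDisc) f ζ / ((ζ.1 - w.1) * (ζ.2 - w.2))) (disc ×ˢ puncDisc)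

/-- The biholomorphism `φ(z₁, z₂) = (z₁ / z₂, z₂)` of the Hartogs triangle onto `𝔻 × 𝔻*`. -/
def phi (z : ℂ × ℂ) : ℂ × ℂ := (z.1 / z.2, z.2)

/-- The inverse `φ⁻¹(w₁, w₂) = (w₁ w₂, w₂)`. -/
def phiInv (w : ℂ × ℂ) : ℂ × ℂ := (w.1 * w.2, w.2)

/-- The pulled-back form `f = (φ⁻¹)^* α` on `𝔻 × 𝔻*`:
`f₁ = w̄₂ (α₁ ∘ φ⁻¹)` and `f₂ = w̄₁ (α₁ ∘ φ⁻¹) + α₂ ∘ φ⁻¹`. -/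
def pullback (α : Form01) : Form01 :=
  ![fun w => conj w.2 * α 0 (phiInv w),
    fun w => conj w.1 * α 0 (phiInv w) + α 1 (phiInv w)]

/-- The measure `|z₂|^s dV` on the Hartogs triangle; `L^p_s` is the `L^p` space of this measure. -/
def weighted (s : ℝ) : Measure (ℂ × ℂ) :=
  (volume.restrict hartogs).withDensity fun z => ENNReal.ofReal (‖z.2‖ ^ s)

end HartogsDbar

end

/-!
On a set of finite area the Cauchy kernel `1 / (ζ - w)` has an `L¹` norm in each variable that is
bounded uniformly in the other one, so by Schur's test the three integral operators in `T` are
bounded on every `L^p`, with bounds that do not depend on `p`. To see that `∂̄(T f) = f` for a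
closed form `f`, move the kernels onto the test function: the Cauchy–Pompeiu formula in one
variable reproduces the coefficient of `f`, and the other two terms cancel because
`∂f₁/∂w̄₂ = ∂f₂/∂w̄₁ = 𝒟f`.

The weak equation `∂̄u = α` is equivalent to `∫ u ∂̄ψ ∧ ∂̄h̄ = -∫ ψ α ∧ ∂̄h̄` for all test
functions `ψ` and holomorphic `h`. In this form it is invariant under a biholomorphism: of the
factor `|J|²` in the change of variables, `J̄` is absorbed by the pull-back of the `(0,2)`-forms and
the holomorphic function `J` by the test function.

Since `φ` has Jacobian `1 / z₂`, it carries `|z₂|⁻² dV` to Lebesgue measure, and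
`𝒟f = (α₁ + z̄₂ ∂α₁/∂z̄₂) ∘ φ⁻¹ + w̄₁ (z̄₂ ∂α₁/∂z̄₁) ∘ φ⁻¹`.
The factors `z̄₂` are what turns the norms of `L^p_{-1}` into norms of `L^p_{-2}`, because
`|z₂|^p |z₂|⁻² ≤ |z₂|⁻¹`.
-/

namespace HartogsDbar

section IntegralOperators

variable {X Y 𝕜 : Type*} [MeasurableSpace X] [MeasurableSpace Y] [RCLike 𝕜]

/-- A measurable kernel all of whose sections have `L¹` norm at most `A`: the hypothesis of
Schur's test. -/
structure IsSchurKernel (μ : Measure X) (K : X → X → 𝕜) (A : ℝ≥0) : Prop where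
  measurable : Measurable (Function.uncurry K)
  left : ∀ w, ∫⁻ ζ, ‖K ζ w‖ₑ ∂μ ≤ A
  right : ∀ ζ, ∫⁻ w, ‖K ζ w‖ₑ ∂μ ≤ A

/-- The integral operator with kernel `K` acting on the first variable of a function of two
variables. The variable of integration is the first argument of the kernel. -/
noncomputable def fstOp (μ : Measure X) (K : X → X → 𝕜) (F : X × Y → 𝕜) (w : X × Y) : 𝕜 :=
  ∫ ζ, F (ζ, w.2) * K ζ w.1 ∂μ

/-- The integral operator with kernel `L` acting on the second variable of a function of two
variables. -/
noncomputable def sndOp (ν : Measure Y) (L : Y → Y → 𝕜) (F : X × Y → 𝕜) (w : X × Y) : 𝕜 :=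
  ∫ ζ, F (w.1, ζ) * L ζ w.2 ∂ν

/-- The integral operator whose kernel is the product of the kernels `K` and `L`. -/
noncomputable def prodOp (μ : Measure X) (ν : Measure Y) (K : X → X → 𝕜) (L : Y → Y → 𝕜)
    (F : X × Y → 𝕜) (w : X × Y) : 𝕜 :=
  ∫ ζ, F ζ * (K ζ.1 w.1 * L ζ.2 w.2) ∂(μ.prod ν)

variable {μ : Measure X} {ν : Measure Y} {K : X → X → 𝕜} {L : Y → Y → 𝕜} {A B : ℝ≥0}

theorem lintegral_mul_rpow_le {h κ : X → ℝ≥0∞} (hh : AEMeasurable h μ) (hκ : AEMeasurable κ μ)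
    {p : ℝ} (hp : 1 ≤ p) :
    (∫⁻ x, h x * κ x ∂μ) ^ p ≤ (∫⁻ x, κ x ∂μ) ^ (p - 1) * ∫⁻ x, h x ^ p * κ x ∂μ := by
  rcases hp.eq_or_lt with rfl | hp1
  · simp
  have hpq := Real.HolderConjugate.conjExponent hp1
  set q := p.conjExponent
  have hp0 : 0 < p := hpq.pos
  have hq0 : 0 < q := hpq.symm.pos
  have inv_add_inv : 1 / p + 1 / q = 1 := by simpa using hpq.inv_add_inv_eq_one
  have inv_mul : 1 / q * p = p - 1 := by
    rw [eq_sub_of_add_eq' inv_add_inv]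
    field_simp
  have split_weight (x) : h x * κ x = h x * κ x ^ (1 / p) * κ x ^ (1 / q) := by
    rw [mul_assoc, ← ENNReal.rpow_add_of_nonneg _ _ (by positivity) (by positivity),
      inv_add_inv, ENNReal.rpow_one]
  have holder := ENNReal.lintegral_mul_le_Lp_mul_Lq μ hpq
    (hh.mul (hκ.pow_const (1 / p))) (hκ.pow_const (1 / q))
  calc (∫⁻ x, h x * κ x ∂μ) ^ p
      ≤ ((∫⁻ x, (h x * κ x ^ (1 / p)) ^ p ∂μ) ^ (1 / p) *
          (∫⁻ x, (κ x ^ (1 / q)) ^ q ∂μ) ^ (1 / q)) ^ p := by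
        simp only [split_weight]
        exact ENNReal.rpow_le_rpow holder hp0.le
    _ = _ := by
        rw [ENNReal.mul_rpow_of_nonneg _ _ hp0.le, ← ENNReal.rpow_mul, ← ENNReal.rpow_mul, inv_mul,
          one_div_mul_cancel hp0.ne', ENNReal.rpow_one, mul_comm]
        simp only [ENNReal.mul_rpow_of_nonneg _ _ hp0.le, ← ENNReal.rpow_mul,
          one_div_mul_cancel hp0.ne', one_div_mul_cancel hq0.ne', ENNReal.rpow_one]

theorem measurePreserving_swap_snd_snd [SFinite μ] [SFinite ν] :
    MeasurePreserving (fun q : (X × Y) × Y => ((q.1.1, q.2), q.1.2))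
      ((μ.prod ν).prod ν) ((μ.prod ν).prod ν) :=
  ((measurePreserving_prodAssoc μ ν ν).symm _).comp
    (((MeasurePreserving.id μ).prod Measure.measurePreserving_swap).comp
      (measurePreserving_prodAssoc μ ν ν))

namespace IsSchurKernel

theorem integrable_mul [SFinite ν] (hL : IsSchurKernel ν L A) {F : X → 𝕜}
    (hF : Integrable F μ) {g : X → Y} (hg : Measurable g) :
    Integrable (fun q : X × Y => F q.1 * L (g q.1) q.2) (μ.prod ν) := by
  have kernel_measurable : Measurable (fun q : X × Y => L (g q.1) q.2) :=
    hL.measurable.comp ((hg.comp measurable_fst).prodMk measurable_snd)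
  have hm : AEStronglyMeasurable (fun q : X × Y => F q.1 * L (g q.1) q.2) (μ.prod ν) :=
    hF.1.comp_fst.mul kernel_measurable.aestronglyMeasurable
  refine ⟨hm, ?_⟩
  rw [hasFiniteIntegral_iff_enorm, lintegral_prod _ hm.enorm]
  calc ∫⁻ x, ∫⁻ y, ‖F x * L (g x) y‖ₑ ∂ν ∂μ ≤ ∫⁻ x, ‖F x‖ₑ * A ∂μ := by
        refine lintegral_mono fun x => ?_
        simp only [enorm_mul]
        rw [lintegral_const_mul' _ _ enorm_ne_top]
        gcongr
        exact hL.right _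
    _ = (∫⁻ x, ‖F x‖ₑ ∂μ) * A := lintegral_mul_const' _ _ ENNReal.coe_ne_top
    _ < ⊤ := ENNReal.mul_lt_top hF.2 ENNReal.coe_lt_top

theorem lintegral_rpow_le [SFinite μ] (hK : IsSchurKernel μ K A) {h : X → ℝ≥0∞}
    (hh : AEMeasurable h μ) {p : ℝ} (hp : 1 ≤ p) :
    ∫⁻ w, (∫⁻ ζ, h ζ * ‖K ζ w‖ₑ ∂μ) ^ p ∂μ ≤ (A : ℝ≥0∞) ^ p * ∫⁻ ζ, h ζ ^ p ∂μ := by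
  have kernel_measurable : Measurable (fun q : X × X => ‖K q.2 q.1‖ₑ) :=
    (hK.measurable.comp measurable_swap).enorm
  calc ∫⁻ w, (∫⁻ ζ, h ζ * ‖K ζ w‖ₑ ∂μ) ^ p ∂μ
      ≤ ∫⁻ w, (A : ℝ≥0∞) ^ (p - 1) * ∫⁻ ζ, h ζ ^ p * ‖K ζ w‖ₑ ∂μ ∂μ := by
        refine lintegral_mono fun w => (lintegral_mul_rpow_le hh
          (kernel_measurable.comp measurable_prodMk_left).aemeasurable hp).trans ?_
        exact mul_le_mul' (ENNReal.rpow_le_rpow (hK.left w) (by linarith)) le_rfl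
    _ = (A : ℝ≥0∞) ^ (p - 1) * ∫⁻ ζ, ∫⁻ w, h ζ ^ p * ‖K ζ w‖ₑ ∂μ ∂μ := by
        rw [lintegral_const_mul' _ _ (ENNReal.rpow_ne_top_of_nonneg (by linarith)
          ENNReal.coe_ne_top), lintegral_lintegral_swap]
        exact ((hh.pow_const p).comp_snd).mul kernel_measurable.aemeasurable
    _ ≤ (A : ℝ≥0∞) ^ (p - 1) * ∫⁻ ζ, h ζ ^ p * A ∂μ := by
        gcongr with ζ
        rw [lintegral_const_mul]
        · gcongr
          exact hK.right ζ
        · exact kernel_measurable.comp measurable_prodMk_right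
    _ = (A : ℝ≥0∞) ^ p * ∫⁻ ζ, h ζ ^ p ∂μ := by
        rw [lintegral_mul_const' _ _ ENNReal.coe_ne_top, mul_comm _ (A : ℝ≥0∞), ← mul_assoc]
        congr 1
        nth_rw 2 [← ENNReal.rpow_one (A : ℝ≥0∞)]
        rw [← ENNReal.rpow_add_of_nonneg _ _ (by linarith) zero_le_one, sub_add_cancel]

theorem eLpNormEssSup_sndOp_le [SFinite ν] (hL : IsSchurKernel ν L A) (F : X × Y → 𝕜) :
    eLpNormEssSup (sndOp ν L F) (μ.prod ν) ≤ A * eLpNormEssSup F (μ.prod ν) := by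
  suffices h : ∀ᵐ x ∂μ, ∀ y, ‖sndOp ν L F (x, y)‖ₑ ≤ A * eLpNormEssSup F (μ.prod ν) from
    essSup_le_of_ae_le _ ((Measure.quasiMeasurePreserving_fst.ae h).mono fun w hw => hw w.2)
  filter_upwards [Measure.ae_ae_of_ae_prod (enorm_ae_le_eLpNormEssSup F (μ.prod ν))] with x hx y
  calc ‖sndOp ν L F (x, y)‖ₑ ≤ ∫⁻ ζ, ‖F (x, ζ) * L ζ y‖ₑ ∂ν := enorm_integral_le_lintegral_enorm _
    _ ≤ ∫⁻ ζ, eLpNormEssSup F (μ.prod ν) * ‖L ζ y‖ₑ ∂ν := by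
        refine lintegral_mono_ae ?_
        filter_upwards [hx] with ζ hζ
        rw [enorm_mul]
        gcongr
    _ = (∫⁻ ζ, ‖L ζ y‖ₑ ∂ν) * eLpNormEssSup F (μ.prod ν) := by
        rw [mul_comm, lintegral_const_mul]
        exact (hL.measurable.comp measurable_prodMk_right).enorm
    _ ≤ A * eLpNormEssSup F (μ.prod ν) := by
        gcongr
        exact hL.left y

variable [SFinite μ] [SFinite ν] {F G ψ ψ' : X × Y → 𝕜}

theorem integrable_snd (hL : IsSchurKernel ν L A) (hF : Integrable F (μ.prod ν)) :
    Integrable (fun q : (X × Y) × Y => F (q.1.1, q.2) * L q.2 q.1.2) ((μ.prod ν).prod ν) :=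
  measurePreserving_swap_snd_snd.integrable_comp_of_integrable
    (hL.integrable_mul hF (g := Prod.snd) measurable_snd)

theorem ae_integrable_snd (hL : IsSchurKernel ν L A) (hF : Integrable F (μ.prod ν)) :
    ∀ᵐ w ∂(μ.prod ν), Integrable (fun ζ => F (w.1, ζ) * L ζ w.2) ν :=
  (hL.integrable_snd hF).prod_right_ae

theorem ae_integrable_fst (hK : IsSchurKernel μ K A) (hF : Integrable F (μ.prod ν)) :
    ∀ᵐ w ∂(μ.prod ν), Integrable (fun ζ => F (ζ, w.2) * K ζ w.1) μ :=
  Measure.measurePreserving_swap.quasiMeasurePreserving.ae (hK.ae_integrable_snd hF.swap)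

theorem ae_integrable_prod (hK : IsSchurKernel μ K A) (hL : IsSchurKernel ν L B)
    (hF : Integrable F (μ.prod ν)) :
    ∀ᵐ w ∂(μ.prod ν),
      Integrable (fun ζ : X × Y => F ζ * (K ζ.1 w.1 * L ζ.2 w.2)) (μ.prod ν) := by
  have h₁ := hK.integrable_mul hF (g := Prod.fst) measurable_fst
  have h₂ := hL.integrable_mul h₁ (g := fun q : (X × Y) × X => q.1.2) (by fun_prop)
  have h₃ : Integrable (fun q : (X × Y) × (X × Y) => F q.1 * K q.1.1 q.2.1 * L q.1.2 q.2.2)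
      ((μ.prod ν).prod (μ.prod ν)) :=
    ((measurePreserving_prodAssoc (μ.prod ν) μ ν).symm _).integrable_comp_of_integrable h₂
  filter_upwards [h₃.prod_left_ae] with w hw
  simpa only [mul_assoc] using hw

theorem integrable_sndOp (hL : IsSchurKernel ν L A) (hF : Integrable F (μ.prod ν)) :
    Integrable (sndOp ν L F) (μ.prod ν) :=
  (hL.integrable_snd hF).integral_prod_left

theorem integrable_fstOp (hK : IsSchurKernel μ K A) (hF : Integrable F (μ.prod ν)) :
    Integrable (fstOp μ K F) (μ.prod ν) :=
  (hK.integrable_sndOp hF.swap).swap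

theorem prodOp_ae_eq_fstOp_sndOp (hK : IsSchurKernel μ K A) (hL : IsSchurKernel ν L B)
    (hF : Integrable F (μ.prod ν)) :
    prodOp μ ν K L F =ᵐ[μ.prod ν] fstOp μ K (sndOp ν L F) := by
  filter_upwards [hK.ae_integrable_prod hL hF] with w hw
  rw [prodOp, integral_prod _ hw]
  simp only [fstOp, sndOp, ← integral_mul_const, mul_assoc, mul_comm (L _ _)]

theorem prodOp_ae_eq_sndOp_fstOp (hK : IsSchurKernel μ K A) (hL : IsSchurKernel ν L B)
    (hF : Integrable F (μ.prod ν)) :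
    prodOp μ ν K L F =ᵐ[μ.prod ν] sndOp ν L (fstOp μ K F) := by
  filter_upwards [hK.ae_integrable_prod hL hF] with w hw
  rw [prodOp, integral_prod_symm _ hw]
  simp only [fstOp, sndOp, ← integral_mul_const, mul_assoc]

theorem integrable_prodOp (hK : IsSchurKernel μ K A) (hL : IsSchurKernel ν L B)
    (hF : Integrable F (μ.prod ν)) : Integrable (prodOp μ ν K L F) (μ.prod ν) :=
  (hK.integrable_fstOp (hL.integrable_sndOp hF)).congr (hK.prodOp_ae_eq_fstOp_sndOp hL hF).symm

theorem lintegral_sndOp_rpow_le (hL : IsSchurKernel ν L A) (hF : Integrable F (μ.prod ν))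
    {p : ℝ} (hp : 1 ≤ p) :
    ∫⁻ w, ‖sndOp ν L F w‖ₑ ^ p ∂(μ.prod ν) ≤
      (A : ℝ≥0∞) ^ p * ∫⁻ w, ‖F w‖ₑ ^ p ∂(μ.prod ν) := by
  rw [lintegral_prod _ ((hL.integrable_sndOp hF).1.enorm.pow_const _),
    lintegral_prod _ (hF.1.enorm.pow_const _), ← lintegral_const_mul' _ _
    (ENNReal.rpow_ne_top_of_nonneg (by linarith) ENNReal.coe_ne_top)]
  refine lintegral_mono_ae ?_
  filter_upwards [hF.prod_right_ae] with x hx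
  refine le_trans ?_ (hL.lintegral_rpow_le hx.1.enorm hp)
  gcongr with y
  refine (enorm_integral_le_lintegral_enorm _).trans_eq ?_
  simp only [enorm_mul]

theorem eLpNorm_sndOp_le (hL : IsSchurKernel ν L A) (hF : Integrable F (μ.prod ν)) {p : ℝ≥0∞}
    (hp : 1 ≤ p) : eLpNorm (sndOp ν L F) p (μ.prod ν) ≤ A * eLpNorm F p (μ.prod ν) := by
  rcases eq_or_ne p ⊤ with rfl | hp_top
  · simpa only [eLpNorm_exponent_top] using hL.eLpNormEssSup_sndOp_le F
  have hp_zero : p ≠ 0 := (zero_lt_one.trans_le hp).ne'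
  have hp_one : 1 ≤ p.toReal := by simpa using ENNReal.toReal_mono hp_top hp
  rw [eLpNorm_eq_lintegral_rpow_enorm_toReal hp_zero hp_top,
    eLpNorm_eq_lintegral_rpow_enorm_toReal hp_zero hp_top]
  calc (∫⁻ w, ‖sndOp ν L F w‖ₑ ^ p.toReal ∂(μ.prod ν)) ^ (1 / p.toReal)
      ≤ ((A : ℝ≥0∞) ^ p.toReal * ∫⁻ w, ‖F w‖ₑ ^ p.toReal ∂(μ.prod ν)) ^ (1 / p.toReal) := by
        gcongr
        exact hL.lintegral_sndOp_rpow_le hF hp_one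
    _ = _ := by
        rw [ENNReal.mul_rpow_of_nonneg _ _ (by positivity), ← ENNReal.rpow_mul,
          mul_one_div_cancel (by linarith), ENNReal.rpow_one]

theorem eLpNorm_fstOp_le (hK : IsSchurKernel μ K A) (hF : Integrable F (μ.prod ν)) {p : ℝ≥0∞}
    (hp : 1 ≤ p) : eLpNorm (fstOp μ K F) p (μ.prod ν) ≤ A * eLpNorm F p (μ.prod ν) := by
  have hswap := Measure.measurePreserving_swap (μ := μ) (ν := ν)
  change eLpNorm (sndOp μ K (F ∘ Prod.swap) ∘ Prod.swap) p _ ≤ _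
  rw [eLpNorm_comp_measurePreserving (hK.integrable_sndOp hF.swap).1 hswap,
    ← eLpNorm_comp_measurePreserving hF.1 Measure.measurePreserving_swap]
  exact hK.eLpNorm_sndOp_le hF.swap hp

theorem eLpNorm_prodOp_le (hK : IsSchurKernel μ K A) (hL : IsSchurKernel ν L B)
    (hF : Integrable F (μ.prod ν)) {p : ℝ≥0∞} (hp : 1 ≤ p) :
    eLpNorm (prodOp μ ν K L F) p (μ.prod ν) ≤ A * B * eLpNorm F p (μ.prod ν) := by
  rw [eLpNorm_congr_ae (hK.prodOp_ae_eq_fstOp_sndOp hL hF), mul_assoc]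
  exact (hK.eLpNorm_fstOp_le (hL.integrable_sndOp hF) hp).trans
    (mul_le_mul_right (hL.eLpNorm_sndOp_le hF hp) _)

theorem integrable_snd_mul (hL : IsSchurKernel ν L A) (hF : Integrable F (μ.prod ν))
    (hψ : Measurable ψ) {c : ℝ} (hc : ∀ w, ‖ψ w‖ ≤ c) :
    Integrable (fun q : (X × Y) × Y => F (q.1.1, q.2) * L q.2 q.1.2 * ψ q.1)
      ((μ.prod ν).prod ν) :=
  (hL.integrable_snd hF).mul_bdd (c := c) (hψ.comp measurable_fst).aestronglyMeasurable
    (.of_forall fun _ => hc _)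

theorem integral_sndOp_mul_eq_integral_prod (hL : IsSchurKernel ν L A)
    (hF : Integrable F (μ.prod ν)) (hψ : Measurable ψ) {c : ℝ} (hc : ∀ w, ‖ψ w‖ ≤ c) :
    ∫ w, sndOp ν L F w * ψ w ∂(μ.prod ν) =
      ∫ q : (X × Y) × Y, F (q.1.1, q.2) * L q.2 q.1.2 * ψ q.1 ∂((μ.prod ν).prod ν) := by
  rw [integral_prod _ (hL.integrable_snd_mul hF hψ hc)]
  simp only [sndOp, integral_mul_const]

theorem integral_sndOp_mul (hL : IsSchurKernel ν L A) (hF : Integrable F (μ.prod ν))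
    (hψ : Measurable ψ) {c : ℝ} (hc : ∀ w, ‖ψ w‖ ≤ c) :
    ∫ w, sndOp ν L F w * ψ w ∂(μ.prod ν) =
      ∫ w, F w * ∫ η, ψ (w.1, η) * L w.2 η ∂ν ∂(μ.prod ν) := by
  have hint := hL.integrable_snd_mul hF hψ hc
  have hswap := measurePreserving_swap_snd_snd (μ := μ) (ν := ν)
  calc ∫ w, sndOp ν L F w * ψ w ∂(μ.prod ν)
      = ∫ q : (X × Y) × Y, F (q.1.1, q.2) * L q.2 q.1.2 * ψ q.1 ∂((μ.prod ν).prod ν) :=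
        hL.integral_sndOp_mul_eq_integral_prod hF hψ hc
    _ = ∫ q : (X × Y) × Y, F q.1 * L q.1.2 q.2 * ψ (q.1.1, q.2) ∂((μ.prod ν).prod ν) := by
        have h := integral_map hswap.measurable.aemeasurable (hswap.map_eq.symm ▸ hint.1)
        rwa [hswap.map_eq] at h
    _ = ∫ w, ∫ η, F w * L w.2 η * ψ (w.1, η) ∂ν ∂(μ.prod ν) :=
        integral_prod _ (hswap.integrable_comp_of_integrable hint)
    _ = _ := by simp only [← integral_const_mul, mul_assoc, mul_comm (L _ _)]

theorem integral_sndOp_mul_eq_iterated (hL : IsSchurKernel ν L A) (hF : Integrable F (μ.prod ν))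
    (hψ : Measurable ψ) {c : ℝ} (hc : ∀ w, ‖ψ w‖ ≤ c) :
    ∫ w, sndOp ν L F w * ψ w ∂(μ.prod ν) =
      ∫ y, ∫ ζ, (∫ x, F (x, ζ) * ψ (x, y) ∂μ) * L ζ y ∂ν ∂ν := by
  have hassoc := (measurePreserving_prodAssoc μ ν ν).symm _
  have hint : Integrable (fun q : X × (Y × Y) => F (q.1, q.2.2) * L q.2.2 q.2.1 * ψ (q.1, q.2.1))
      (μ.prod (ν.prod ν)) :=
    hassoc.integrable_comp_of_integrable (hL.integrable_snd_mul hF hψ hc)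
  calc ∫ w, sndOp ν L F w * ψ w ∂(μ.prod ν)
      = ∫ q : (X × Y) × Y, F (q.1.1, q.2) * L q.2 q.1.2 * ψ q.1 ∂((μ.prod ν).prod ν) :=
        hL.integral_sndOp_mul_eq_integral_prod hF hψ hc
    _ = ∫ q : X × (Y × Y), F (q.1, q.2.2) * L q.2.2 q.2.1 * ψ (q.1, q.2.1)
          ∂(μ.prod (ν.prod ν)) :=
        (hassoc.integral_comp MeasurableEquiv.prodAssoc.symm.measurableEmbedding _).symm
    _ = ∫ w : Y × Y, ∫ x, F (x, w.2) * L w.2 w.1 * ψ (x, w.1) ∂μ ∂(ν.prod ν) :=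
        integral_prod_symm _ hint
    _ = ∫ y, ∫ ζ, ∫ x, F (x, ζ) * L ζ y * ψ (x, y) ∂μ ∂ν ∂ν :=
        integral_prod _ hint.integral_prod_right
    _ = _ := by simp only [← integral_mul_const, mul_assoc, mul_comm (L _ _)]

theorem integral_sndOp_mul_of_inverse (hL : IsSchurKernel ν L A) (hF : Integrable F (μ.prod ν))
    (hψ' : Measurable ψ') {b : ℝ} (hb : ∀ w, ‖ψ' w‖ ≤ b) {c : 𝕜}
    (hinv : ∀ x ζ, ∫ η, ψ' (x, η) * L ζ η ∂ν = c * ψ (x, ζ)) :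
    ∫ w, sndOp ν L F w * ψ' w ∂(μ.prod ν) = c * ∫ w, F w * ψ w ∂(μ.prod ν) := by
  rw [hL.integral_sndOp_mul hF hψ' hb, ← integral_const_mul]
  simp only [hinv, Prod.mk.eta, mul_left_comm]

theorem integral_fstOp_mul_of_inverse (hK : IsSchurKernel μ K A) (hF : Integrable F (μ.prod ν))
    (hψ' : Measurable ψ') {b : ℝ} (hb : ∀ w, ‖ψ' w‖ ≤ b) {c : 𝕜}
    (hinv : ∀ y ζ, ∫ η, ψ' (η, y) * K ζ η ∂μ = c * ψ (ζ, y)) :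
    ∫ w, fstOp μ K F w * ψ' w ∂(μ.prod ν) = c * ∫ w, F w * ψ w ∂(μ.prod ν) := by
  rw [← integral_prod_swap, ← integral_prod_swap (f := fun w => F w * ψ w)]
  exact hK.integral_sndOp_mul_of_inverse (ψ := ψ ∘ Prod.swap) hF.swap
    (hψ'.comp measurable_swap) (fun w => hb w.swap) hinv

theorem integral_sndOp_mul_congr (hL : IsSchurKernel ν L A)
    (hF : Integrable F (μ.prod ν)) (hG : Integrable G (μ.prod ν))
    (hψ : Measurable ψ) {c : ℝ} (hc : ∀ w, ‖ψ w‖ ≤ c)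
    (hψ' : Measurable ψ') {c' : ℝ} (hc' : ∀ w, ‖ψ' w‖ ≤ c')
    (h : ∀ y, ∀ᵐ ζ ∂ν, ∫ x, F (x, ζ) * ψ' (x, y) ∂μ = -∫ x, G (x, ζ) * ψ (x, y) ∂μ) :
    ∫ w, sndOp ν L F w * ψ' w ∂(μ.prod ν) = -∫ w, sndOp ν L G w * ψ w ∂(μ.prod ν) := by
  rw [hL.integral_sndOp_mul_eq_iterated hF hψ' hc', hL.integral_sndOp_mul_eq_iterated hG hψ hc,
    ← integral_neg]
  refine integral_congr_ae (.of_forall fun y => ?_)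
  simp only [← integral_neg]
  refine integral_congr_ae ?_
  filter_upwards [h y] with ζ hζ
  rw [hζ, neg_mul]

theorem integral_fstOp_mul_congr (hK : IsSchurKernel μ K A)
    (hF : Integrable F (μ.prod ν)) (hG : Integrable G (μ.prod ν))
    (hψ : Measurable ψ) {c : ℝ} (hc : ∀ w, ‖ψ w‖ ≤ c)
    (hψ' : Measurable ψ') {c' : ℝ} (hc' : ∀ w, ‖ψ' w‖ ≤ c')
    (h : ∀ x, ∀ᵐ ζ ∂μ, ∫ y, F (ζ, y) * ψ' (x, y) ∂ν = -∫ y, G (ζ, y) * ψ (x, y) ∂ν) :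
    ∫ w, fstOp μ K F w * ψ' w ∂(μ.prod ν) = -∫ w, fstOp μ K G w * ψ w ∂(μ.prod ν) := by
  rw [← integral_prod_swap, ← integral_prod_swap (f := fun w => fstOp μ K G w * ψ w)]
  exact hK.integral_sndOp_mul_congr hF.swap hG.swap (hψ.comp measurable_swap)
    (fun w => hc w.swap) (hψ'.comp measurable_swap) (fun w => hc' w.swap) h

end IsSchurKernel

end IntegralOperators

section AntilinearPart

variable {E F : Type*} [NormedAddCommGroup E] [NormedSpace ℂ E] [NormedAddCommGroup F]
  [NormedSpace ℂ F]

/-- The conjugate-linear part of a real-linear map. If `D` is the derivative of `φ` at `z`, this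
is `∂̄φ(z)`. -/
noncomputable def antilinearPart (D : E →L[ℝ] F) : E →ₗ⋆[ℂ] F where
  toFun v := (1 / 2 : ℂ) • (D v + I • D (I • v))
  map_add' v w := by
    simp only [smul_add, map_add]
    module
  map_smul' c v := by
    have map_complex_smul (w : E) : D (c • w) = c.re • D w + c.im • D (I • w) := by
      nth_rw 1 [← re_add_im c]
      rw [add_smul, mul_smul, coe_smul, coe_smul, map_add, map_smul, map_smul]
    have I_smul_I_smul : I • I • v = -v := by rw [smul_smul, I_mul_I, neg_one_smul]
    have conj_eq : starRingEnd ℂ c = c.re - c.im * I := Complex.ext (by simp) (by simp)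
    rw [smul_comm I c v, map_complex_smul, map_complex_smul, I_smul_I_smul, map_neg, conj_eq]
    simp only [← coe_smul]
    match_scalars
    · ring
    · linear_combination (1 / 2 : ℂ) * c.im * I_sq

theorem antilinearPart_apply (D : E →L[ℝ] ℂ) (v : E) :
    antilinearPart D v = (1 / 2) * (D v + I * D (I • v)) := rfl

theorem antilinearPart_fderiv_comp {G : Type*} [NormedAddCommGroup G] [NormedSpace ℂ G]
    {ψ : F → G} {Φ : E → F} {L : E →L[ℂ] F} {z : E} (hψ : DifferentiableAt ℝ ψ (Φ z))
    (hΦ : HasFDerivAt Φ L z) (v : E) :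
    antilinearPart (fderiv ℝ (ψ ∘ Φ) z) v = antilinearPart (fderiv ℝ ψ (Φ z)) (L v) := by
  rw [(hψ.hasFDerivAt.comp z (hΦ.restrictScalars ℝ)).fderiv]
  simp [antilinearPart]

theorem antilinearPart_fderiv_mul {f g : E → ℂ} {z : E} (hf : DifferentiableAt ℝ f z)
    (hg : DifferentiableAt ℝ g z) (v : E) :
    antilinearPart (fderiv ℝ (fun x => f x * g x) z) v =
      f z * antilinearPart (fderiv ℝ g z) v + g z * antilinearPart (fderiv ℝ f z) v := by
  rw [fderiv_fun_mul hf hg]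
  simp only [antilinearPart_apply, add_apply, _root_.smul_apply,
    smul_eq_mul]
  ring

theorem antilinearPart_fderiv_of_differentiableAt {h : E → F} {z : E}
    (hh : DifferentiableAt ℂ h z) : antilinearPart (fderiv ℝ h z) = 0 := by
  ext v
  rw [hh.fderiv_restrictScalars ℝ]
  simp [antilinearPart, smul_smul]

theorem antilinearPart_fderiv_conj {h : E → ℂ} {h' : E →L[ℂ] ℂ} {z : E}
    (hh : HasFDerivAt h h' z) (v : E) :
    antilinearPart (fderiv ℝ (fun x => conj (h x)) z) v = conj (h' v) := by
  have hconj : HasFDerivAt (fun x => conj (h x)) _ z :=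
    (conjCLE : ℂ →L[ℝ] ℂ).hasFDerivAt.comp z (hh.restrictScalars ℝ)
  rw [hconj.fderiv, antilinearPart_apply]
  simp only [ContinuousLinearMap.comp_apply, ContinuousLinearMap.coe_restrictScalars', map_smul,
    smul_eq_mul, ContinuousLinearEquiv.coe_coe, conjCLE_apply, map_mul, conj_I]
  linear_combination (-1 / 2) * conj (h' v) * I_sq

end AntilinearPart

section CauchyKernel

theorem setLIntegral_enorm_inv_ball_lt_top : ∫⁻ x in Metric.ball (0 : ℂ) 1, ‖x⁻¹‖ₑ < ⊤ := by
  have h : IntegrableOn (fun x : ℂ => x⁻¹) (Metric.ball 0 1) volume := by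
    refine integrableOn_ball_of_norm_le_rpow (C := 1) (α := 1) (by simp) (by simp) ?_
      measurable_inv.aestronglyMeasurable
    exact .of_forall fun x => by rw [norm_inv, Real.rpow_neg_one, one_mul]
  exact h.2

/-- The Cauchy kernel `1 / (ζ - w)`, with the junk value `0` on the diagonal. -/
noncomputable def cauchyKernel (ζ w : ℂ) : ℂ := (ζ - w)⁻¹

theorem lintegral_cauchyKernel_le (U : Set ℂ) (w : ℂ) :
    ∫⁻ ζ in U, ‖cauchyKernel ζ w‖ₑ ≤
      (∫⁻ x in Metric.ball (0 : ℂ) 1, ‖x⁻¹‖ₑ) + volume U := by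
  set f : ℂ → ℝ≥0∞ := (Metric.ball (0 : ℂ) 1).indicator fun x => ‖x⁻¹‖ₑ
  have enorm_inv_le (x : ℂ) : ‖x⁻¹‖ₑ ≤ f x + 1 := by
    by_cases hx : x ∈ Metric.ball (0 : ℂ) 1
    · simp [f, hx]
    · refine le_add_left ?_
      rw [← ofReal_norm, ← ENNReal.ofReal_one, norm_inv]
      exact ENNReal.ofReal_le_ofReal (inv_le_one_of_one_le₀ (by simpa using hx))
  calc ∫⁻ ζ in U, ‖cauchyKernel ζ w‖ₑ ≤ ∫⁻ ζ in U, (f (ζ - w) + 1) :=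
        lintegral_mono fun ζ => enorm_inv_le _
    _ = (∫⁻ ζ in U, f (ζ - w)) + volume U := by
        rw [lintegral_add_right _ measurable_const, lintegral_one, Measure.restrict_apply_univ]
    _ ≤ (∫⁻ ζ, f (ζ - w)) + volume U := by
        gcongr
        exact Measure.restrict_le_self
    _ = _ := by
        rw [lintegral_sub_right_eq_self f w, lintegral_indicator measurableSet_ball]

theorem exists_isSchurKernel_cauchyKernel {U : Set ℂ} (hU : volume U ≠ ⊤) :
    ∃ A : ℝ≥0, IsSchurKernel (volume.restrict U) cauchyKernel A := by
  obtain ⟨A, hA⟩ : ∃ A : ℝ≥0, (A : ℝ≥0∞) =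
      (∫⁻ x in Metric.ball (0 : ℂ) 1, ‖x⁻¹‖ₑ) + volume U :=
    ⟨_, ENNReal.coe_toNNReal
      (ENNReal.add_ne_top.2 ⟨setLIntegral_enorm_inv_ball_lt_top.ne, hU⟩)⟩
  refine ⟨A, (measurable_fst.sub measurable_snd).inv, fun w => ?_, fun ζ => ?_⟩
  · rw [hA]
    exact lintegral_cauchyKernel_le U w
  · have enorm_symm (w : ℂ) : ‖cauchyKernel ζ w‖ₑ = ‖cauchyKernel w ζ‖ₑ := by
      rw [cauchyKernel, cauchyKernel, ← neg_sub, inv_neg, enorm_neg]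
    simp only [enorm_symm, hA]
    exact lintegral_cauchyKernel_le U ζ

end CauchyKernel

section CauchyPompeiu

open Set

theorem integral_Ioi_fderiv_smul {E F : Type*} [NormedAddCommGroup E] [NormedSpace ℝ E]
    [NormedAddCommGroup F] [NormedSpace ℝ F] [CompleteSpace F] {φ : E → F} (hφ : ContDiff ℝ 1 φ)
    (hc : HasCompactSupport φ) {u : E} (hu : u ≠ 0) :
    ∫ r in Ioi (0 : ℝ), fderiv ℝ φ (r • u) u = -φ 0 := by
  have hray : ContDiff ℝ 1 fun r : ℝ => r • u := contDiff_id.smul contDiff_const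
  have hderiv (r : ℝ) : deriv (fun r : ℝ => φ (r • u)) r = fderiv ℝ φ (r • u) u := by
    have h := (hφ.differentiable one_ne_zero (r • u)).hasFDerivAt.comp_hasDerivAt r
      ((hasDerivAt_id r).smul_const u)
    rw [one_smul] at h
    exact h.deriv
  have h := (hc.comp_isClosedEmbedding (isClosedEmbedding_smul_left hu)).integral_Ioi_deriv_eq
    (hφ.comp hray) 0
  simpa only [Function.comp_def, hderiv, zero_smul] using h

theorem integral_Ioo_fderiv_circle {φ : ℂ → ℂ} (hφ : ContDiff ℝ 1 φ) {r : ℝ} (hr : r ≠ 0) :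
    ∫ θ in Ioo (-Real.pi) Real.pi,
      fderiv ℝ φ (r * exp (θ * I)) (I * exp (θ * I)) = 0 := by
  have hcircle (θ : ℝ) :
      HasDerivAt (fun θ : ℝ => (r : ℂ) * exp (θ * I)) (r • (I * exp (θ * I))) θ := by
    simpa [mul_comm I] using
      (((hasDerivAt_id θ).ofReal_comp.mul_const I).cexp.const_mul (r : ℂ))
  have hderiv (θ : ℝ) : HasDerivAt (fun θ : ℝ => φ (r * exp (θ * I)))
      (r • fderiv ℝ φ (r * exp (θ * I)) (I * exp (θ * I))) θ := by
    have h := (hφ.differentiable one_ne_zero (r * exp (θ * I))).hasFDerivAt.comp_hasDerivAt θ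
      (hcircle θ)
    rwa [map_smul] at h
  have hcont : Continuous fun θ : ℝ => r • fderiv ℝ φ (r * exp (θ * I)) (I * exp (θ * I)) :=
    (((hφ.continuous_fderiv one_ne_zero).comp (by fun_prop)).clm_apply (by fun_prop)).const_smul r
  have hftc := intervalIntegral.integral_eq_sub_of_hasDerivAt (fun θ _ => hderiv θ)
    (hcont.intervalIntegrable (-Real.pi) Real.pi)
  have hperiod : (r : ℂ) * exp ((Real.pi : ℝ) * I) = r * exp ((-Real.pi : ℝ) * I) := by
    simp [exp_neg, exp_pi_mul_I]
  rw [hperiod, sub_self, intervalIntegral.integral_of_le (by linarith [Real.pi_pos]),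
    integral_Ioc_eq_integral_Ioo, integral_smul] at hftc
  exact (smul_eq_zero.1 hftc).resolve_left hr

theorem integrableOn_polarCoord_target_clm_apply {F G : Type*} [NormedAddCommGroup F]
    [NormedSpace ℝ F] [NormedAddCommGroup G] [NormedSpace ℝ G] {D : ℂ → F →L[ℝ] G}
    (hD : Continuous D) (hc : HasCompactSupport D) {V : ℝ → F} (hV : Continuous V) :
    IntegrableOn (fun q : ℝ × ℝ => D (q.1 * exp (q.2 * I)) (V q.2)) polarCoord.target := by
  obtain ⟨R, -, hR⟩ := hc.isCompact.isBounded.exists_pos_norm_lt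
  have hcont : Continuous fun q : ℝ × ℝ => D (q.1 * exp (q.2 * I)) (V q.2) :=
    (hD.comp (by fun_prop)).clm_apply (hV.comp continuous_snd)
  have hcompact : IsCompact (Icc (0 : ℝ) R ×ˢ Icc (-Real.pi) Real.pi) :=
    isCompact_Icc.prod isCompact_Icc
  refine (hcont.continuousOn.integrableOn_compact hcompact).of_forall_sdiff_eq_zero
    polarCoord.open_target.measurableSet ?_
  rintro ⟨r, θ⟩ ⟨⟨hr, hθ⟩, hq⟩
  have hfar : (r : ℂ) * exp (θ * I) ∉ tsupport D := by
    intro hmem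
    have h := hR _ hmem
    rw [norm_mul, norm_exp_ofReal_mul_I, mul_one, norm_real, Real.norm_eq_abs] at h
    exact hq ⟨⟨hr.le, (le_abs_self r).trans h.le⟩, Ioo_subset_Icc_self hθ⟩
  simp only [image_eq_zero_of_notMem_tsupport hfar, zero_apply]

variable {φ : ℂ → ℂ}

theorem integral_polarCoord_target_radial (hφ : ContDiff ℝ 1 φ) (hc : HasCompactSupport φ) :
    ∫ q in polarCoord.target, fderiv ℝ φ (q.1 * exp (q.2 * I)) (exp (q.2 * I)) =
      -(2 * Real.pi) * φ 0 := by
  have hint := integrableOn_polarCoord_target_clm_apply (hφ.continuous_fderiv one_ne_zero)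
    (hc.fderiv ℝ) (V := fun θ => exp (θ * I)) (by fun_prop)
  have hray (θ : ℝ) : ∫ r in Ioi (0 : ℝ), fderiv ℝ φ (r * exp (θ * I)) (exp (θ * I)) = -φ 0 := by
    simpa only [real_smul] using integral_Ioi_fderiv_smul hφ hc (exp_ne_zero (θ * I))
  rw [IntegrableOn, polarCoord_target, Measure.volume_eq_prod, ← Measure.prod_restrict] at hint
  rw [polarCoord_target, Measure.volume_eq_prod, ← Measure.prod_restrict, integral_prod_symm _ hint]
  simp only [hray, integral_const, measureReal_restrict_apply_univ, Real.volume_real_Ioo]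
  rw [max_eq_left (by linarith [Real.pi_pos]), real_smul]
  push_cast
  ring

theorem integral_polarCoord_target_angular (hφ : ContDiff ℝ 1 φ) (hc : HasCompactSupport φ) :
    ∫ q in polarCoord.target, fderiv ℝ φ (q.1 * exp (q.2 * I)) (I * exp (q.2 * I)) = 0 := by
  have hint := integrableOn_polarCoord_target_clm_apply (hφ.continuous_fderiv one_ne_zero)
    (hc.fderiv ℝ) (V := fun θ => I * exp (θ * I)) (by fun_prop)
  rw [polarCoord_target] at hint ⊢
  rw [Measure.volume_eq_prod, setIntegral_prod _ hint]
  refine integral_eq_zero_of_ae ?_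
  filter_upwards [ae_restrict_mem measurableSet_Ioi] with r hr
  exact integral_Ioo_fderiv_circle hφ (ne_of_gt hr)

theorem antilinearPart_one_eq_exp_mul (D : ℂ →L[ℝ] ℂ) (θ : ℝ) :
    antilinearPart D 1 =
      (1 / 2) * (D (exp (θ * I)) + I * D (I * exp (θ * I))) * exp (θ * I) := by
  have hsmul := (antilinearPart D).map_smulₛₗ (exp (θ * I)) 1
  have hunit : conj (exp (θ * I)) * exp (θ * I) = 1 := by
    rw [← normSq_eq_conj_mul_self, normSq_eq_norm_sq, norm_exp_ofReal_mul_I]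
    simp
  rw [smul_eq_mul, mul_one, antilinearPart_apply, smul_eq_mul, smul_eq_mul] at hsmul
  rw [hsmul]
  linear_combination (-antilinearPart D 1) * hunit

theorem integral_antilinearPart_mul_inv (hφ : ContDiff ℝ 1 φ) (hc : HasCompactSupport φ) :
    ∫ x, antilinearPart (fderiv ℝ φ x) 1 * x⁻¹ = -Real.pi * φ 0 := by
  have hint {V : ℝ → ℂ} (hV : Continuous V) := integrableOn_polarCoord_target_clm_apply
    (hφ.continuous_fderiv one_ne_zero) (hc.fderiv ℝ) hV
  calc ∫ x, antilinearPart (fderiv ℝ φ x) 1 * x⁻¹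
      = ∫ q in polarCoord.target, (1 / 2 : ℂ) *
          (fderiv ℝ φ (q.1 * exp (q.2 * I)) (exp (q.2 * I)) +
            I * fderiv ℝ φ (q.1 * exp (q.2 * I)) (I * exp (q.2 * I))) := by
        rw [← Complex.integral_comp_polarCoord_symm]
        refine setIntegral_congr_fun polarCoord.open_target.measurableSet fun q hq => ?_
        have hr : (q.1 : ℂ) ≠ 0 := ofReal_ne_zero.2 (ne_of_gt hq.1)
        have hpolar : Complex.polarCoord.symm q = q.1 * exp (q.2 * I) := by
          rw [Complex.polarCoord_symm_apply, exp_mul_I, ofReal_cos, ofReal_sin]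
        simp only [hpolar]
        rw [antilinearPart_one_eq_exp_mul _ q.2, real_smul]
        have hexp := exp_ne_zero (q.2 * I)
        field_simp
    _ = -Real.pi * φ 0 := by
        rw [integral_const_mul, integral_add (hint (V := fun θ => exp (θ * I)) (by fun_prop))
          ((hint (V := fun θ => I * exp (θ * I)) (by fun_prop)).const_mul I),
          integral_const_mul, integral_polarCoord_target_radial hφ hc,
          integral_polarCoord_target_angular hφ hc]
        ring

theorem integral_antilinearPart_mul_cauchyKernel (hφ : ContDiff ℝ 1 φ)
    (hc : HasCompactSupport φ) (ζ : ℂ) :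
    ∫ η, antilinearPart (fderiv ℝ φ η) 1 * cauchyKernel ζ η = Real.pi * φ ζ := by
  have htranslate := integral_antilinearPart_mul_inv (φ := fun x => φ (ζ + x))
    (hφ.comp (contDiff_const.add contDiff_id)) (hc.comp_homeomorph (Homeomorph.addLeft ζ))
  calc ∫ η, antilinearPart (fderiv ℝ φ η) 1 * cauchyKernel ζ η
      = ∫ x, antilinearPart (fderiv ℝ φ (ζ + x)) 1 * cauchyKernel ζ (ζ + x) :=
        (integral_add_left_eq_self (fun η => _ * cauchyKernel ζ η) ζ).symm
    _ = -∫ x, antilinearPart (fderiv ℝ (fun x => φ (ζ + x)) x) 1 * x⁻¹ := by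
        simp only [cauchyKernel, sub_add_cancel_left, inv_neg, mul_neg, integral_neg,
          fderiv_comp_add_left]
    _ = Real.pi * φ ζ := by
        rw [htranslate, add_zero]
        ring

end CauchyPompeiu

section TestFunctions

variable {Ω : Set (ℂ × ℂ)} {ψ u : ℂ × ℂ → ℂ} {j : Fin 2}

theorem dbar_eq_antilinearPart (j : Fin 2) (ψ : ℂ × ℂ → ℂ) (z : ℂ × ℂ) :
    dbar j ψ z = antilinearPart (fderiv ℝ ψ z) (coordVec j) := rfl

theorem isTestFunction_of_isCompact {K : Set (ℂ × ℂ)} (hψ : ∀ z ∈ K, ContDiffAt ℝ ∞ ψ z)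
    (hK : IsCompact K) (hKΩ : K ⊆ Ω) (h : ∀ z, z ∉ K → ψ z = 0) : IsTestFunction Ω ψ := by
  have hs : tsupport ψ ⊆ K := closure_minimal
    (fun z hz => by_contra fun hzK => hz (h z hzK)) hK.isClosed
  refine ⟨contDiff_iff_contDiffAt.2 fun z => ?_, .intro hK h, hs.trans hKΩ⟩
  by_cases hz : z ∈ tsupport ψ
  · exact hψ z (hs hz)
  · exact contDiffAt_const.congr_of_eventuallyEq (notMem_tsupport_iff_eventuallyEq.1 hz)

theorem isTestFunction_prod {U V : Set ℂ} {θ χ : ℂ → ℂ} (hθ : ContDiff ℝ ∞ θ)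
    (hχ : ContDiff ℝ ∞ χ) (hθc : HasCompactSupport θ) (hχc : HasCompactSupport χ)
    (hθU : tsupport θ ⊆ U) (hχV : tsupport χ ⊆ V) :
    IsTestFunction (U ×ˢ V) fun z => θ z.1 * χ z.2 := by
  refine isTestFunction_of_isCompact
    (fun z _ => ((hθ.comp contDiff_fst).mul (hχ.comp contDiff_snd)).contDiffAt)
    (hθc.isCompact.prod hχc.isCompact) (Set.prod_mono hθU hχV) fun z hz => ?_
  by_cases h1 : z.1 ∈ tsupport θ
  · rw [image_eq_zero_of_notMem_tsupport fun h2 => hz ⟨h1, h2⟩, mul_zero]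
  · rw [image_eq_zero_of_notMem_tsupport h1, zero_mul]

namespace IsTestFunction

theorem differentiableAt (hψ : IsTestFunction Ω ψ) (z : ℂ × ℂ) : DifferentiableAt ℝ ψ z :=
  hψ.1.differentiable (by simp) z

theorem eq_zero (hψ : IsTestFunction Ω ψ) {z : ℂ × ℂ} (hz : z ∉ Ω) : ψ z = 0 :=
  image_eq_zero_of_notMem_tsupport fun h => hz (hψ.2.2 h)

theorem exists_bound (hψ : IsTestFunction Ω ψ) : ∃ c, ∀ z, ‖ψ z‖ ≤ c :=
  hψ.2.1.exists_bound_of_continuous hψ.1.continuous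

theorem mul (hψ : IsTestFunction Ω ψ) {a : ℂ × ℂ → ℂ} (ha : ∀ z ∈ Ω, ContDiffAt ℝ ∞ a z) :
    IsTestFunction Ω fun z => a z * ψ z :=
  isTestFunction_of_isCompact (fun z hz => (ha z (hψ.2.2 hz)).mul hψ.1.contDiffAt)
    hψ.2.1.isCompact hψ.2.2 fun z hz => by rw [image_eq_zero_of_notMem_tsupport hz, mul_zero]

theorem dbar (hψ : IsTestFunction Ω ψ) (j : Fin 2) : IsTestFunction Ω (dbar j ψ) := by
  refine isTestFunction_of_isCompact (fun z _ => ?_) hψ.2.1.isCompact hψ.2.2 fun z hz => ?_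
  · have hD : ContDiff ℝ ∞ (fderiv ℝ ψ) := hψ.1.fderiv_right (by simp)
    exact (contDiff_const.mul ((hD.clm_apply contDiff_const).add
      (contDiff_const.mul (hD.clm_apply contDiff_const)))).contDiffAt
  · have : fderiv ℝ ψ z = 0 :=
      image_eq_zero_of_notMem_tsupport fun h => hz (tsupport_fderiv_subset ℝ h)
    simp [HartogsDbar.dbar, this]

theorem integrableOn_mul (hψ : IsTestFunction Ω ψ) (hΩ : MeasurableSet Ω)
    (hu : LocallyIntegrableOn u Ω) : IntegrableOn (fun z => u z * ψ z) Ω := by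
  obtain ⟨c, hc⟩ := hψ.exists_bound
  have h : IntegrableOn (fun z => u z * ψ z) (tsupport ψ) :=
    (hu.integrableOn_compact_subset hψ.2.2 hψ.2.1.isCompact).mul_bdd (c := c)
      hψ.1.continuous.aestronglyMeasurable (.of_forall hc)
  refine h.of_forall_sdiff_eq_zero hΩ fun z hz => ?_
  rw [image_eq_zero_of_notMem_tsupport hz.2, mul_zero]

theorem comp {U V : Set (ℂ × ℂ)} {Φ Ψ : ℂ × ℂ → ℂ × ℂ} (hψ : IsTestFunction V ψ)
    (hΦ : ∀ z ∈ U, ContDiffAt ℝ ∞ Φ z) (hΨ : ContinuousOn Ψ V) (hmaps : Set.MapsTo Ψ V U)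
    (hinv : ∀ z, Φ z ∈ V → Ψ (Φ z) = z) : IsTestFunction U (ψ ∘ Φ) := by
  have hsub : Ψ '' tsupport ψ ⊆ U := (hmaps.mono_left hψ.2.2).image_subset
  refine isTestFunction_of_isCompact (K := Ψ '' tsupport ψ)
    (fun z hz => hψ.1.contDiffAt.comp z (hΦ z (hsub hz)))
    (hψ.2.1.isCompact.image_of_continuousOn (hΨ.mono hψ.2.2)) hsub fun z hz => ?_
  exact image_eq_zero_of_notMem_tsupport (f := ψ) fun h => hz ⟨_, h, hinv z (hψ.2.2 h)⟩

theorem comp_swap {U V : Set ℂ} (hψ : IsTestFunction (U ×ˢ V) ψ) :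
    IsTestFunction (V ×ˢ U) (ψ ∘ Prod.swap) :=
  hψ.comp (fun _ _ => (contDiff_snd.prodMk contDiff_fst).contDiffAt)
    continuous_swap.continuousOn (fun _ hz => ⟨hz.2, hz.1⟩) fun _ _ => rfl

section Product

variable {U V : Set ℂ}

theorem slice_fst (hψ : IsTestFunction (U ×ˢ V) ψ) (b : ℂ) :
    ContDiff ℝ ∞ (fun x => ψ (x, b)) ∧ HasCompactSupport (fun x => ψ (x, b)) ∧
      tsupport (fun x => ψ (x, b)) ⊆ U := by
  have hzero : ∀ x, x ∉ Prod.fst '' tsupport ψ → ψ (x, b) = 0 := fun x hx =>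
    image_eq_zero_of_notMem_tsupport fun h => hx ⟨_, h, rfl⟩
  have hcompact : IsCompact (Prod.fst '' tsupport ψ) := hψ.2.1.isCompact.image continuous_fst
  refine ⟨hψ.1.comp (contDiff_id.prodMk contDiff_const), .intro hcompact hzero, ?_⟩
  calc tsupport (fun x => ψ (x, b)) ⊆ Prod.fst '' tsupport ψ :=
        closure_minimal (fun x hx => by_contra fun h => hx (hzero x h)) hcompact.isClosed
    _ ⊆ U := by
        rintro _ ⟨z, hz, rfl⟩
        exact (hψ.2.2 hz).1

theorem dbar_zero_eq_slice (hψ : IsTestFunction Ω ψ) (a b : ℂ) :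
    HartogsDbar.dbar 0 ψ (a, b) = antilinearPart (fderiv ℝ (fun x => ψ (x, b)) a) 1 :=
  (antilinearPart_fderiv_comp (Φ := fun x => (x, b)) (hψ.differentiableAt (a, b))
    (hasFDerivAt_prodMk_left a b) 1).symm

theorem dbar_one_eq_dbar_zero_comp_swap (hψ : IsTestFunction Ω ψ) (a b : ℂ) :
    HartogsDbar.dbar 1 ψ (a, b) = HartogsDbar.dbar 0 (ψ ∘ Prod.swap) (b, a) :=
  (antilinearPart_fderiv_comp (Φ := Prod.swap) (z := (b, a)) (hψ.differentiableAt (a, b))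
    (ContinuousLinearEquiv.prodComm ℂ ℂ ℂ).hasFDerivAt (coordVec 0)).symm

theorem integral_dbar_zero_mul_cauchyKernel (hψ : IsTestFunction (U ×ˢ V) ψ) (b ζ : ℂ) :
    ∫ η in U, HartogsDbar.dbar 0 ψ (η, b) * cauchyKernel ζ η = Real.pi * ψ (ζ, b) := by
  rw [setIntegral_eq_integral_of_forall_compl_eq_zero fun η hη => by
    rw [(hψ.dbar 0).eq_zero fun h => hη h.1, zero_mul]]
  simp only [hψ.dbar_zero_eq_slice]
  exact integral_antilinearPart_mul_cauchyKernel ((hψ.slice_fst b).1.of_le (by simp))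
    (hψ.slice_fst b).2.1 ζ

theorem integral_dbar_one_mul_cauchyKernel (hψ : IsTestFunction (U ×ˢ V) ψ) (a ζ : ℂ) :
    ∫ η in V, HartogsDbar.dbar 1 ψ (a, η) * cauchyKernel ζ η = Real.pi * ψ (a, ζ) := by
  simp only [hψ.dbar_one_eq_dbar_zero_comp_swap]
  exact hψ.comp_swap.integral_dbar_zero_mul_cauchyKernel a ζ

end Product

end IsTestFunction

theorem ae_eq_of_integral_mul_testFunction_eq {g g' : ℂ × ℂ → ℂ} (hΩ : IsOpen Ω)
    (hg : LocallyIntegrableOn g Ω) (hg' : LocallyIntegrableOn g' Ω)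
    (h : ∀ ψ, IsTestFunction Ω ψ → ∫ z in Ω, g z * ψ z = ∫ z in Ω, g' z * ψ z) :
    g =ᵐ[volume.restrict Ω] g' := by
  have hzero : ∀ᵐ z, z ∈ Ω → (g - g') z = 0 := by
    refine hΩ.ae_eq_zero_of_integral_contDiff_smul_eq_zero (hg.sub hg') fun χ hχ hχc hχΩ => ?_
    have htest : IsTestFunction Ω fun z => (χ z : ℂ) :=
      isTestFunction_of_isCompact (fun z _ => (ofRealCLM.contDiff.comp hχ).contDiffAt)
        hχc.isCompact hχΩ fun z hz => by rw [image_eq_zero_of_notMem_tsupport hz, ofReal_zero]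
    calc ∫ z, χ z • (g - g') z = ∫ z in Ω, χ z • (g - g') z :=
          (setIntegral_eq_integral_of_forall_compl_eq_zero fun z hz => by
            rw [image_eq_zero_of_notMem_tsupport fun h => hz (hχΩ h), zero_smul]).symm
      _ = ∫ z in Ω, (g z * χ z - g' z * χ z) := by
          refine integral_congr_ae (.of_forall fun z => ?_)
          simp only [real_smul, Pi.sub_apply]
          ring
      _ = 0 := by
          rw [integral_sub (htest.integrableOn_mul hΩ.measurableSet hg)
            (htest.integrableOn_mul hΩ.measurableSet hg'), h _ htest, sub_self]
  rw [Filter.EventuallyEq, ae_restrict_iff' hΩ.measurableSet]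
  filter_upwards [hzero] with z hz hzΩ
  exact sub_eq_zero.1 (hz hzΩ)

end TestFunctions

section WeakDerivative

variable {Ω : Set (ℂ × ℂ)} {u g g' : ℂ × ℂ → ℂ} {j : Fin 2} {f : Form01}

namespace HasWeakDbar

theorem congr_right (h : HasWeakDbar Ω j u g) (hg : g =ᵐ[volume.restrict Ω] g') :
    HasWeakDbar Ω j u g' := by
  refine ⟨h.1, fun z hz => ?_, fun ψ hψ => ?_⟩
  · obtain ⟨t, ht, hgt⟩ := h.2.1 z hz
    refine ⟨t ∩ Ω, Filter.inter_mem ht self_mem_nhdsWithin,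
      (hgt.mono_set Set.inter_subset_left).congr_fun_ae ?_⟩
    exact ae_mono (Measure.restrict_mono_set _ Set.inter_subset_right) hg
  · rw [h.2.2 ψ hψ]
    exact congrArg Neg.neg (integral_congr_ae (hg.mul (ae_eq_refl ψ)))

theorem conj_mul (hu : HasWeakDbar Ω j u g) (hΩ : IsOpen Ω) {h : ℂ × ℂ → ℂ}
    (hh : ∀ z ∈ Ω, ContDiffAt ℂ ∞ h z) :
    HasWeakDbar Ω j (fun z => conj (h z) * u z)
      fun z => conj (h z) * g z + conj (fderiv ℂ h z (coordVec j)) * u z := by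
  have hh' (z) (hz : z ∈ Ω) : HasFDerivAt h (fderiv ℂ h z) z :=
    ((hh z hz).differentiableAt (by simp)).hasFDerivAt
  have hconj (z) (hz : z ∈ Ω) : ContDiffAt ℝ ∞ (fun z => conj (h z)) z :=
    conjCLE.contDiff.contDiffAt.comp z ((hh z hz).restrict_scalars ℝ)
  have hconj' (z) (hz : z ∈ Ω) : ContDiffAt ℝ ∞ (fun z => conj (fderiv ℂ h z (coordVec j))) z :=
    conjCLE.contDiff.contDiffAt.comp z
      (((hh z hz).fderiv_right (m := ∞) (by simp)).clm_apply contDiffAt_const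
        |>.restrict_scalars ℝ)
  have hloc {v k : ℂ × ℂ → ℂ} (hv : LocallyIntegrableOn v Ω)
      (hk : ∀ z ∈ Ω, ContDiffAt ℝ ∞ k z) : LocallyIntegrableOn (fun z => k z * v z) Ω :=
    hv.continuousOn_mul (fun z hz => (hk z hz).continuousAt.continuousWithinAt)
      hΩ.isLocallyClosed
  refine ⟨hloc hu.1 hconj, (hloc hu.2.1 hconj).add (hloc hu.1 hconj'), fun ψ hψ => ?_⟩
  have hψh := hψ.mul hconj
  have leibniz (z) (hz : z ∈ Ω) : conj (h z) * u z * dbar j ψ z =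
      u z * dbar j (fun z => conj (h z) * ψ z) z
        - conj (fderiv ℂ h z (coordVec j)) * u z * ψ z := by
    rw [dbar_eq_antilinearPart, dbar_eq_antilinearPart, antilinearPart_fderiv_mul
      ((hconj z hz).differentiableAt (by simp)) (hψ.differentiableAt z),
      antilinearPart_fderiv_conj (hh' z hz)]
    ring
  rw [setIntegral_congr_fun hΩ.measurableSet leibniz,
    integral_sub ((hψh.dbar j).integrableOn_mul hΩ.measurableSet hu.1)
      (hψ.integrableOn_mul hΩ.measurableSet (hloc hu.1 hconj')), hu.2.2 _ hψh,
    ← neg_add', ← integral_add (hψh.integrableOn_mul hΩ.measurableSet hu.2.1)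
      (hψ.integrableOn_mul hΩ.measurableSet (hloc hu.1 hconj'))]
  refine congrArg Neg.neg (integral_congr_ae (.of_forall fun z => ?_))
  ring

theorem comp_swap {U V : Set ℂ} (h : HasWeakDbar (U ×ˢ V) 1 u g) :
    HasWeakDbar (V ×ˢ U) 0 (u ∘ Prod.swap) (g ∘ Prod.swap) := by
  have hswap : MeasurePreserving (Prod.swap : ℂ × ℂ → ℂ × ℂ) := Measure.measurePreserving_swap
  have hemb : MeasurableEmbedding (Prod.swap : ℂ × ℂ → ℂ × ℂ) :=
    MeasurableEquiv.prodComm.measurableEmbedding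
  have hpre : Prod.swap ⁻¹' (U ×ˢ V) = V ×ˢ U := Set.preimage_swap_prod ..
  have hloc {v : ℂ × ℂ → ℂ} (hv : LocallyIntegrableOn v (U ×ˢ V)) :
      LocallyIntegrableOn (v ∘ Prod.swap) (V ×ˢ U) := by
    intro z hz
    obtain ⟨t, ht, hvt⟩ := hv z.swap ⟨hz.2, hz.1⟩
    refine ⟨Prod.swap ⁻¹' t, ?_, (hswap.integrableOn_comp_preimage hemb).2 hvt⟩
    exact continuous_swap.continuousWithinAt.tendsto_nhdsWithin (fun _ hx => And.symm hx) ht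
  refine ⟨hloc h.1, hloc h.2.1, fun ψ hψ => ?_⟩
  have hdbar (z : ℂ × ℂ) : dbar 0 ψ z.swap = dbar 1 (ψ ∘ Prod.swap) z :=
    (hψ.comp_swap.dbar_one_eq_dbar_zero_comp_swap z.1 z.2).symm
  have key := h.2.2 _ hψ.comp_swap
  simp only [← hdbar] at key
  rw [← hswap.setIntegral_preimage_emb hemb _ (U ×ˢ V),
    ← hswap.setIntegral_preimage_emb hemb (fun z => g z * _) (U ×ˢ V), hpre] at key
  simpa only [Function.comp_apply, Prod.swap_swap] using key

end HasWeakDbar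

theorem IsWeaklyDbarClosed.isScriptD (hf : IsWeaklyDbarClosed Ω f)
    (h : HasWeakDbar Ω 1 (f 0) g) : IsScriptD Ω f g := by
  refine ⟨hf.1, h.2.1, fun ψ hψ => ?_⟩
  rw [← hf.2 ψ hψ, h.2.2 ψ hψ]
  ring

namespace IsScriptD

theorem hasWeakDbar_zero (hg : IsScriptD Ω f g) (hf : IsWeaklyDbarClosed Ω f) :
    HasWeakDbar Ω 1 (f 0) g :=
  ⟨hf.1 0, hg.2.1, fun ψ hψ => by
    rw [← hg.2.2 ψ hψ, ← hf.2 ψ hψ]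
    ring⟩

theorem hasWeakDbar_one (hg : IsScriptD Ω f g) (hf : IsWeaklyDbarClosed Ω f) :
    HasWeakDbar Ω 0 (f 1) g :=
  ⟨hf.1 1, hg.2.1, fun ψ hψ => by
    rw [← hf.2 ψ hψ]
    exact (hg.hasWeakDbar_zero hf).2.2 ψ hψ⟩

theorem ae_eq (hΩ : IsOpen Ω) (hg : IsScriptD Ω f g) (hg' : IsScriptD Ω f g') :
    g =ᵐ[volume.restrict Ω] g' :=
  ae_eq_of_integral_mul_testFunction_eq hΩ hg.2.1 hg'.2.1 fun ψ hψ =>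
    neg_inj.1 ((hg.2.2 ψ hψ).symm.trans (hg'.2.2 ψ hψ))

theorem isScriptD_scriptD (hg : IsScriptD Ω f g) : IsScriptD Ω f (scriptD Ω f) := by
  have h : ∃ g, IsScriptD Ω f g := ⟨g, hg⟩
  rw [scriptD, dif_pos h]
  exact h.choose_spec

end IsScriptD

end WeakDerivative

section Product

variable {U V : Set ℂ} {F G ψ : ℂ × ℂ → ℂ} {f : Form01} {g : ℂ × ℂ → ℂ} {A B : ℝ≥0}

theorem volume_restrict_prod (U V : Set ℂ) :
    (volume.restrict (U ×ˢ V) : Measure (ℂ × ℂ)) =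
      (volume.restrict U).prod (volume.restrict V) := by
  rw [Measure.volume_eq_prod, Measure.prod_restrict]

theorem ae_integral_slice_eq_zero {X : Type*} [MeasurableSpace X] {μ : Measure X} [SFinite μ]
    {H : X × ℂ → ℂ} (hV : IsOpen V) (hH : Integrable H (μ.prod (volume.restrict V)))
    (h : ∀ χ : ℂ → ℝ, ContDiff ℝ ∞ χ → HasCompactSupport χ → tsupport χ ⊆ V →
      ∫ z, χ z.2 • H z ∂(μ.prod (volume.restrict V)) = 0) :
    ∀ᵐ ζ ∂(volume.restrict V), ∫ x, H (x, ζ) ∂μ = 0 := by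
  rw [ae_restrict_iff' hV.measurableSet]
  have hint : IntegrableOn (fun ζ => ∫ x, H (x, ζ) ∂μ) V := hH.integral_prod_right
  refine hV.ae_eq_zero_of_integral_contDiff_smul_eq_zero hint.locallyIntegrableOn
    fun χ hχ hχc hχV => ?_
  obtain ⟨c, hc⟩ := hχc.exists_bound_of_continuous hχ.continuous
  calc ∫ ζ, χ ζ • ∫ x, H (x, ζ) ∂μ
      = ∫ ζ in V, χ ζ • ∫ x, H (x, ζ) ∂μ :=
        (setIntegral_eq_integral_of_forall_compl_eq_zero fun ζ hζ => by
          rw [image_eq_zero_of_notMem_tsupport fun hs => hζ (hχV hs), zero_smul]).symm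
    _ = ∫ z, χ z.2 • H z ∂(μ.prod (volume.restrict V)) := by
        have hχH : Integrable (fun z : X × ℂ => χ z.2 • H z) (μ.prod (volume.restrict V)) :=
          hH.bdd_smul c (hχ.continuous.measurable.comp measurable_snd).aestronglyMeasurable
            (.of_forall fun z => hc _)
        simp only [integral_prod_symm _ hχH, integral_smul]
    _ = 0 := h χ hχ hχc hχV

namespace HasWeakDbar

theorem integral_smul_slice_eq_zero (h : HasWeakDbar (U ×ˢ V) 0 F G)
    (hUV : MeasurableSet (U ×ˢ V)) (hψ : IsTestFunction (U ×ˢ V) ψ) (b : ℂ) {χ : ℂ → ℝ}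
    (hχ : ContDiff ℝ ∞ χ) (hχc : HasCompactSupport χ) (hχV : tsupport χ ⊆ V) :
    ∫ z in U ×ˢ V, χ z.2 • (F z * dbar 0 ψ (z.1, b) + G z * ψ (z.1, b)) = 0 := by
  obtain ⟨hθ, hθc, hθU⟩ := hψ.slice_fst b
  have hχ_tsupport : tsupport (fun x => (χ x : ℂ)) ⊆ tsupport χ :=
    closure_mono fun x hx h0 => hx (by simp [h0])
  have htest : IsTestFunction (U ×ˢ V) fun z => ψ (z.1, b) * χ z.2 :=
    isTestFunction_prod hθ (ofRealCLM.contDiff.comp hχ) hθc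
      (hχc.of_isClosed_subset (isClosed_tsupport _) hχ_tsupport) hθU (hχ_tsupport.trans hχV)
  have dbar_tensor (z : ℂ × ℂ) :
      dbar 0 (fun z => ψ (z.1, b) * (χ z.2 : ℂ)) z = χ z.2 * dbar 0 ψ (z.1, b) := by
    rw [← Prod.mk.eta (p := z), htest.dbar_zero_eq_slice, hψ.dbar_zero_eq_slice]
    change antilinearPart (fderiv ℝ (fun x => ψ (x, b) * (χ z.2 : ℂ)) z.1) 1 = _
    rw [antilinearPart_fderiv_mul (hθ.differentiable (by simp) _) (differentiableAt_const _),
      antilinearPart_fderiv_of_differentiableAt (differentiableAt_const _)]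
    simp
  have split (z : ℂ × ℂ) : χ z.2 • (F z * dbar 0 ψ (z.1, b) + G z * ψ (z.1, b)) =
      F z * dbar 0 (fun z => ψ (z.1, b) * (χ z.2 : ℂ)) z + G z * (ψ (z.1, b) * χ z.2) := by
    rw [dbar_tensor, real_smul]
    ring
  simp only [split]
  rw [integral_add ((htest.dbar 0).integrableOn_mul hUV h.1) (htest.integrableOn_mul hUV h.2.1),
    h.2.2 _ htest, neg_add_cancel]

theorem ae_slice_fst (h : HasWeakDbar (U ×ˢ V) 0 F G) (hU : MeasurableSet U) (hV : IsOpen V)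
    (hF : IntegrableOn F (U ×ˢ V)) (hG : IntegrableOn G (U ×ˢ V))
    (hψ : IsTestFunction (U ×ˢ V) ψ) (b : ℂ) :
    ∀ᵐ ζ ∂(volume.restrict V),
      ∫ x in U, F (x, ζ) * dbar 0 ψ (x, b) = -∫ x in U, G (x, ζ) * ψ (x, b) := by
  have integrable_mul_slice {H θ : ℂ × ℂ → ℂ} (hH : IntegrableOn H (U ×ˢ V))
      (hθ : IsTestFunction (U ×ˢ V) θ) : Integrable (fun z : ℂ × ℂ => H z * θ (z.1, b))
        ((volume.restrict U).prod (volume.restrict V)) := by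
    obtain ⟨c, hc⟩ := hθ.exists_bound
    rw [← volume_restrict_prod]
    exact hH.mul_bdd (c := c) (hθ.1.continuous.comp (by fun_prop)).aestronglyMeasurable
      (.of_forall fun z => hc _)
  have hF' := integrable_mul_slice hF (hψ.dbar 0)
  have hG' := integrable_mul_slice hG hψ
  have hzero := ae_integral_slice_eq_zero hV (hF'.add hG') fun χ hχ hχc hχV => by
    rw [← volume_restrict_prod]
    exact h.integral_smul_slice_eq_zero (hU.prod hV.measurableSet) hψ b hχ hχc hχV
  filter_upwards [hzero, hF'.prod_left_ae, hG'.prod_left_ae] with ζ hζ hFζ hGζ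
  simp only [Pi.add_apply] at hζ
  rwa [integral_add hFζ hGζ, ← eq_neg_iff_add_eq_zero] at hζ

theorem ae_slice_snd (h : HasWeakDbar (U ×ˢ V) 1 F G) (hU : IsOpen U) (hV : MeasurableSet V)
    (hF : IntegrableOn F (U ×ˢ V)) (hG : IntegrableOn G (U ×ˢ V))
    (hψ : IsTestFunction (U ×ˢ V) ψ) (a : ℂ) :
    ∀ᵐ ζ ∂(volume.restrict U),
      ∫ y in V, F (ζ, y) * dbar 1 ψ (a, y) = -∫ y in V, G (ζ, y) * ψ (a, y) := by
  rw [IntegrableOn, volume_restrict_prod] at hF hG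
  have hF' : IntegrableOn (F ∘ Prod.swap) (V ×ˢ U) := by
    rw [IntegrableOn, volume_restrict_prod]
    exact hF.swap
  have hG' : IntegrableOn (G ∘ Prod.swap) (V ×ˢ U) := by
    rw [IntegrableOn, volume_restrict_prod]
    exact hG.swap
  simp only [hψ.dbar_one_eq_dbar_zero_comp_swap]
  exact h.comp_swap.ae_slice_fst hV hU hF' hG' hψ.comp_swap a

end HasWeakDbar

/-- The integral operator `T` on a general product domain `U × V`, with a given function `g` in
the role of `𝒟f`, written with Cauchy transforms against Lebesgue measure. -/
noncomputable def solOp (U V : Set ℂ) (f : Form01) (g : ℂ × ℂ → ℂ) (w : ℂ × ℂ) : ℂ :=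
  -(1 / Real.pi) * sndOp (volume.restrict V) cauchyKernel (f 1) w
  + -(1 / Real.pi) * fstOp (volume.restrict U) cauchyKernel (f 0) w
  + -(1 / Real.pi) ^ 2 *
    prodOp (volume.restrict U) (volume.restrict V) cauchyKernel cauchyKernel g w

theorem solOp_scriptD_eq_T (f : Form01) :
    solOp disc puncDisc f (scriptD (disc ×ˢ puncDisc) f) = T f := by
  funext w
  simp only [solOp, T, sndOp, fstOp, prodOp, cauchyKernel, div_eq_mul_inv, mul_inv,
    volume_restrict_prod, integral_mul_const]
  have hI := I_ne_zero
  field_simp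

section SolutionOperator

variable (hK : IsSchurKernel (volume.restrict U) cauchyKernel A)
  (hL : IsSchurKernel (volume.restrict V) cauchyKernel B)

include hK hL

theorem integrableOn_solOp (hf : ∀ j, IntegrableOn (f j) (U ×ˢ V))
    (hg : IntegrableOn g (U ×ˢ V)) : IntegrableOn (solOp U V f g) (U ×ˢ V) := by
  simp only [IntegrableOn, volume_restrict_prod] at hf hg ⊢
  exact (((hL.integrable_sndOp (hf 1)).const_mul _).add
    ((hK.integrable_fstOp (hf 0)).const_mul _)).add
    ((hK.integrable_prodOp hL hg).const_mul _)

theorem eLpNorm_solOp_le (hf : ∀ j, IntegrableOn (f j) (U ×ˢ V))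
    (hg : IntegrableOn g (U ×ˢ V)) {p : ℝ≥0∞} (hp : 1 ≤ p) :
    eLpNorm (solOp U V f g) p (volume.restrict (U ×ˢ V)) ≤
      B * eLpNorm (f 1) p (volume.restrict (U ×ˢ V)) +
      A * eLpNorm (f 0) p (volume.restrict (U ×ˢ V)) +
      A * B * eLpNorm g p (volume.restrict (U ×ˢ V)) := by
  simp only [IntegrableOn, volume_restrict_prod] at hf hg ⊢
  have eLpNorm_const_mul_le {c : ℂ} (hc : ‖c‖ ≤ 1) (F : ℂ × ℂ → ℂ) :
      eLpNorm (fun w => c * F w) p ((volume.restrict U).prod (volume.restrict V)) ≤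
        eLpNorm F p ((volume.restrict U).prod (volume.restrict V)) :=
    eLpNorm_mono fun w => by
      rw [norm_mul]
      exact mul_le_of_le_one_left (norm_nonneg _) hc
  have norm_inv_pi_le : ‖-(1 / Real.pi : ℂ)‖ ≤ 1 := by
    rw [norm_neg, norm_div, norm_one, norm_real, Real.norm_eq_abs, abs_of_pos Real.pi_pos]
    exact (div_le_one Real.pi_pos).2 (by linarith [Real.pi_gt_three])
  have norm_inv_pi_sq_le : ‖-(1 / Real.pi : ℂ) ^ 2‖ ≤ 1 := by
    rw [norm_neg, norm_pow, ← norm_neg]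
    exact pow_le_one₀ (norm_nonneg _) norm_inv_pi_le
  have h₁ := (hL.integrable_sndOp (hf 1)).const_mul (-(1 / Real.pi : ℂ))
  have h₀ := (hK.integrable_fstOp (hf 0)).const_mul (-(1 / Real.pi : ℂ))
  have h₂ := (hK.integrable_prodOp hL hg).const_mul (-(1 / Real.pi : ℂ) ^ 2)
  refine (eLpNorm_add_le (h₁.add h₀).1 h₂.1 hp).trans (add_le_add
    ((eLpNorm_add_le h₁.1 h₀.1 hp).trans (add_le_add ?_ ?_)) ?_)
  · exact (eLpNorm_const_mul_le norm_inv_pi_le _).trans (hL.eLpNorm_sndOp_le (hf 1) hp)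
  · exact (eLpNorm_const_mul_le norm_inv_pi_le _).trans (hK.eLpNorm_fstOp_le (hf 0) hp)
  · exact (eLpNorm_const_mul_le norm_inv_pi_sq_le _).trans (hK.eLpNorm_prodOp_le hL hg hp)

theorem integral_solOp_mul (hf : ∀ j, IntegrableOn (f j) (U ×ˢ V))
    (hg : IntegrableOn g (U ×ˢ V)) (hψ : IsTestFunction (U ×ˢ V) ψ) :
    ∫ w in U ×ˢ V, solOp U V f g w * ψ w =
      -(1 / Real.pi) * (∫ w in U ×ˢ V, sndOp (volume.restrict V) cauchyKernel (f 1) w * ψ w)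
      + -(1 / Real.pi) * (∫ w in U ×ˢ V, fstOp (volume.restrict U) cauchyKernel (f 0) w * ψ w)
      + -(1 / Real.pi) ^ 2 * ∫ w in U ×ˢ V,
        prodOp (volume.restrict U) (volume.restrict V) cauchyKernel cauchyKernel g w * ψ w := by
  simp only [IntegrableOn, volume_restrict_prod] at hf hg ⊢
  obtain ⟨c, hc⟩ := hψ.exists_bound
  have integrable_mul {F : ℂ × ℂ → ℂ}
      (hF : Integrable F ((volume.restrict U).prod (volume.restrict V))) (a : ℂ) :
      Integrable (fun w => a * (F w * ψ w)) ((volume.restrict U).prod (volume.restrict V)) :=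
    (hF.mul_bdd (c := c) hψ.1.continuous.aestronglyMeasurable (.of_forall hc)).const_mul a
  have h₁ := integrable_mul (hL.integrable_sndOp (hf 1)) (-(1 / Real.pi : ℂ))
  have h₀ := integrable_mul (hK.integrable_fstOp (hf 0)) (-(1 / Real.pi : ℂ))
  have h₂ := integrable_mul (hK.integrable_prodOp hL hg) (-(1 / Real.pi : ℂ) ^ 2)
  simp only [solOp, add_mul, mul_assoc, ← integral_const_mul]
  exact (integral_add (h₁.add h₀) h₂).trans (congrArg (· + _) (integral_add h₁ h₀))

theorem integral_solOp_mul_dbar_zero (hf : ∀ j, IntegrableOn (f j) (U ×ˢ V))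
    (hg : IntegrableOn g (U ×ˢ V)) (hU : MeasurableSet U) (hV : IsOpen V)
    (h : HasWeakDbar (U ×ˢ V) 0 (f 1) g) (hψ : IsTestFunction (U ×ˢ V) ψ) :
    ∫ w in U ×ˢ V, solOp U V f g w * dbar 0 ψ w = -∫ w in U ×ˢ V, f 0 w * ψ w := by
  obtain ⟨c, hc⟩ := hψ.exists_bound
  obtain ⟨c', hc'⟩ := (hψ.dbar 0).exists_bound
  have hψm := hψ.1.continuous.measurable
  have hdm := (hψ.dbar 0).1.continuous.measurable
  have slices := h.ae_slice_fst hU hV (hf 1) hg hψ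
  rw [integral_solOp_mul hK hL hf hg (hψ.dbar 0)]
  simp only [IntegrableOn, volume_restrict_prod] at hf hg ⊢
  have hprod : ∫ w, prodOp (volume.restrict U) (volume.restrict V) cauchyKernel cauchyKernel g w *
      dbar 0 ψ w ∂((volume.restrict U).prod (volume.restrict V)) =
      Real.pi * ∫ w, sndOp (volume.restrict V) cauchyKernel g w * ψ w
        ∂((volume.restrict U).prod (volume.restrict V)) := by
    refine (integral_congr_ae
      ((hK.prodOp_ae_eq_fstOp_sndOp hL hg).mul (ae_eq_refl (dbar 0 ψ)))).trans ?_
    exact hK.integral_fstOp_mul_of_inverse (hL.integrable_sndOp hg) hdm hc'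
      hψ.integral_dbar_zero_mul_cauchyKernel
  rw [hL.integral_sndOp_mul_congr (hf 1) hg hψm hc hdm hc' slices,
    hK.integral_fstOp_mul_of_inverse (hf 0) hdm hc' hψ.integral_dbar_zero_mul_cauchyKernel, hprod]
  field_simp
  ring

theorem integral_solOp_mul_dbar_one (hf : ∀ j, IntegrableOn (f j) (U ×ˢ V))
    (hg : IntegrableOn g (U ×ˢ V)) (hU : IsOpen U) (hV : MeasurableSet V)
    (h : HasWeakDbar (U ×ˢ V) 1 (f 0) g) (hψ : IsTestFunction (U ×ˢ V) ψ) :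
    ∫ w in U ×ˢ V, solOp U V f g w * dbar 1 ψ w = -∫ w in U ×ˢ V, f 1 w * ψ w := by
  obtain ⟨c, hc⟩ := hψ.exists_bound
  obtain ⟨c', hc'⟩ := (hψ.dbar 1).exists_bound
  have hψm := hψ.1.continuous.measurable
  have hdm := (hψ.dbar 1).1.continuous.measurable
  have slices := h.ae_slice_snd hU hV (hf 0) hg hψ
  rw [integral_solOp_mul hK hL hf hg (hψ.dbar 1)]
  simp only [IntegrableOn, volume_restrict_prod] at hf hg ⊢
  have hprod : ∫ w, prodOp (volume.restrict U) (volume.restrict V) cauchyKernel cauchyKernel g w *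
      dbar 1 ψ w ∂((volume.restrict U).prod (volume.restrict V)) =
      Real.pi * ∫ w, fstOp (volume.restrict U) cauchyKernel g w * ψ w
        ∂((volume.restrict U).prod (volume.restrict V)) := by
    refine (integral_congr_ae
      ((hK.prodOp_ae_eq_sndOp_fstOp hL hg).mul (ae_eq_refl (dbar 1 ψ)))).trans ?_
    exact hL.integral_sndOp_mul_of_inverse (hK.integrable_fstOp hg) hdm hc'
      hψ.integral_dbar_one_mul_cauchyKernel
  rw [hK.integral_fstOp_mul_congr (hf 0) hg hψm hc hdm hc' slices,
    hL.integral_sndOp_mul_of_inverse (hf 1) hdm hc' hψ.integral_dbar_one_mul_cauchyKernel, hprod]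
  field_simp
  ring

theorem isWeakSolution_solOp (hf : ∀ j, IntegrableOn (f j) (U ×ˢ V))
    (hg : IntegrableOn g (U ×ˢ V)) (hU : IsOpen U) (hV : IsOpen V)
    (h₀ : HasWeakDbar (U ×ˢ V) 1 (f 0) g) (h₁ : HasWeakDbar (U ×ˢ V) 0 (f 1) g) :
    IsWeakSolution (U ×ˢ V) (solOp U V f g) f := by
  have hT := (integrableOn_solOp hK hL hf hg).locallyIntegrableOn
  refine Fin.forall_fin_two.2 ⟨⟨hT, (hf 0).locallyIntegrableOn, fun ψ hψ => ?_⟩,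
    ⟨hT, (hf 1).locallyIntegrableOn, fun ψ hψ => ?_⟩⟩
  · exact integral_solOp_mul_dbar_zero hK hL hf hg hU.measurableSet hV h₁ hψ
  · exact integral_solOp_mul_dbar_one hK hL hf hg hU hV.measurableSet h₀ hψ

end SolutionOperator

end Product

section Forms

variable {Ω : Set (ℂ × ℂ)} {Φ Ψ : ℂ × ℂ → ℂ × ℂ} {ψ h u : ℂ × ℂ → ℂ} {α : Form01} {z : ℂ × ℂ}

/-- The form `∂̄ψ`, for a smooth function `ψ`. -/
noncomputable def dbarForm (ψ : ℂ × ℂ → ℂ) : Form01 := fun j => dbar j ψ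

/-- The coefficient of `dz̄₁ ∧ dz̄₂` in `α ∧ β`. -/
def wedge (α β : Form01) (z : ℂ × ℂ) : ℂ := α 0 z * β 1 z - α 1 z * β 0 z

/-- The pull-back `Φ^*α` under a holomorphic map `Φ = (Φ₁, Φ₂)`, whose coefficients are
`(Φ^*α)ⱼ = ∑ₖ conj (∂Φₖ/∂zⱼ) (αₖ ∘ Φ)`. -/
noncomputable def formPullback (Φ : ℂ × ℂ → ℂ × ℂ) (α : Form01) : Form01 := fun j z =>
  conj (fderiv ℂ Φ z (coordVec j)).1 * α 0 (Φ z) + conj (fderiv ℂ Φ z (coordVec j)).2 * α 1 (Φ z)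

/-- The complex Jacobian determinant of a holomorphic map. -/
noncomputable def jacobian (Φ : ℂ × ℂ → ℂ × ℂ) (z : ℂ × ℂ) : ℂ :=
  (fderiv ℂ Φ z (coordVec 0)).1 * (fderiv ℂ Φ z (coordVec 1)).2 -
    (fderiv ℂ Φ z (coordVec 1)).1 * (fderiv ℂ Φ z (coordVec 0)).2

theorem eq_smul_coordVec_add (v : ℂ × ℂ) : v = v.1 • coordVec 0 + v.2 • coordVec 1 := by
  simp [coordVec]

theorem wedge_formPullback (Φ : ℂ × ℂ → ℂ × ℂ) (α β : Form01) (z : ℂ × ℂ) :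
    wedge (formPullback Φ α) (formPullback Φ β) z = conj (jacobian Φ z) * wedge α β (Φ z) := by
  simp only [wedge, formPullback, jacobian, map_sub, map_mul]
  ring

theorem formPullback_dbarForm (hψ : DifferentiableAt ℝ ψ (Φ z)) (hΦ : DifferentiableAt ℂ Φ z)
    (j : Fin 2) : formPullback Φ (dbarForm ψ) j z = dbarForm (ψ ∘ Φ) j z := by
  simp only [formPullback, dbarForm, dbar_eq_antilinearPart]
  rw [antilinearPart_fderiv_comp hψ hΦ.hasFDerivAt]
  nth_rw 3 [eq_smul_coordVec_add (fderiv ℂ Φ z (coordVec j))]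
  rw [map_add, LinearMap.map_smulₛₗ, LinearMap.map_smulₛₗ, smul_eq_mul, smul_eq_mul]

theorem formPullback_comp (hΨ : DifferentiableAt ℂ Ψ (Φ z)) (hΦ : DifferentiableAt ℂ Φ z)
    (α : Form01) (j : Fin 2) :
    formPullback Φ (formPullback Ψ α) j z = formPullback (Ψ ∘ Φ) α j z := by
  have chain : fderiv ℂ (Ψ ∘ Φ) z (coordVec j) =
      (fderiv ℂ Φ z (coordVec j)).1 • fderiv ℂ Ψ (Φ z) (coordVec 0) +
        (fderiv ℂ Φ z (coordVec j)).2 • fderiv ℂ Ψ (Φ z) (coordVec 1) := by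
    rw [fderiv_comp z hΨ hΦ, ContinuousLinearMap.comp_apply, ← map_smul, ← map_smul, ← map_add,
      ← eq_smul_coordVec_add]
  simp only [formPullback, chain, Function.comp_apply, Prod.fst_add, Prod.snd_add, Prod.smul_fst,
    Prod.smul_snd, smul_eq_mul, map_add, map_mul]
  ring

theorem formPullback_id (α : Form01) : formPullback id α = α := by
  funext j z
  fin_cases j <;> simp [formPullback, coordVec]

theorem contDiffAt_jacobian (hΦ : ContDiffAt ℂ ∞ Φ z) : ContDiffAt ℂ ∞ (jacobian Φ) z := by
  have hpartial (j : Fin 2) : ContDiffAt ℂ ∞ (fun z => fderiv ℂ Φ z (coordVec j)) z :=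
    (hΦ.fderiv_right (m := ∞) (by simp)).clm_apply contDiffAt_const
  exact ((hpartial 0).fst.mul (hpartial 1).snd).sub ((hpartial 1).fst.mul (hpartial 0).snd)

theorem det_fderiv_restrictScalars (Φ : ℂ × ℂ → ℂ × ℂ) (z : ℂ × ℂ) :
    ((fderiv ℂ Φ z).restrictScalars ℝ).det = normSq (jacobian Φ z) := by
  have det_eq : LinearMap.det (fderiv ℂ Φ z : ℂ × ℂ →ₗ[ℂ] ℂ × ℂ) = jacobian Φ z := by
    rw [← LinearMap.det_toMatrix (Module.Basis.finTwoProd ℂ), Matrix.det_fin_two]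
    simp [LinearMap.toMatrix_apply, jacobian, coordVec]
  rw [← det_eq, ← Algebra.norm_complex_apply]
  exact LinearMap.det_restrictScalars (R := ℝ) (S := ℂ)

theorem dbarForm_mul_of_differentiableAt (hh : DifferentiableAt ℂ h z)
    (hψ : DifferentiableAt ℝ ψ z) (j : Fin 2) :
    dbarForm (fun z => h z * ψ z) j z = h z * dbarForm ψ j z := by
  simp only [dbarForm, dbar_eq_antilinearPart]
  rw [antilinearPart_fderiv_mul (hh.restrictScalars ℝ) hψ,
    antilinearPart_fderiv_of_differentiableAt hh]
  simp

theorem dbarForm_conj (hh : DifferentiableAt ℂ h z) (j : Fin 2) :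
    dbarForm (fun z => conj (h z)) j z = conj (fderiv ℂ h z (coordVec j)) :=
  antilinearPart_fderiv_conj hh.hasFDerivAt _

theorem isWeaklyDbarClosed_iff (hΩ : MeasurableSet Ω) : IsWeaklyDbarClosed Ω α ↔
    (∀ j, LocallyIntegrableOn (α j) Ω) ∧
      ∀ ψ, IsTestFunction Ω ψ → ∫ z in Ω, wedge α (dbarForm ψ) z = 0 := by
  refine and_congr_right fun hα => forall₂_congr fun ψ hψ => ?_
  simp only [wedge, dbarForm]
  rw [integral_sub ((hψ.dbar 1).integrableOn_mul hΩ (hα 0))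
    ((hψ.dbar 0).integrableOn_mul hΩ (hα 1)), sub_eq_zero]

theorem IsWeakSolution.integral_mul_wedge (hu : IsWeakSolution Ω u α) (hΩ : IsOpen Ω)
    (hh : ∀ z ∈ Ω, ContDiffAt ℂ ∞ h z) (hψ : IsTestFunction Ω ψ) :
    ∫ z in Ω, u z * wedge (dbarForm ψ) (dbarForm fun z => conj (h z)) z =
      -∫ z in Ω, ψ z * wedge α (dbarForm fun z => conj (h z)) z := by
  have hpartial (j : Fin 2) (z) (hz : z ∈ Ω) :
      ContDiffAt ℂ ∞ (fun z => fderiv ℂ h z (coordVec j)) z :=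
    ((hh z hz).fderiv_right (m := ∞) (by simp)).clm_apply contDiffAt_const
  have partial_comm (z) (hz : z ∈ Ω) :
      fderiv ℂ (fun z => fderiv ℂ h z (coordVec 1)) z (coordVec 0) =
        fderiv ℂ (fun z => fderiv ℂ h z (coordVec 0)) z (coordVec 1) := by
    have hd : DifferentiableAt ℂ (fderiv ℂ h) z :=
      ((hh z hz).fderiv_right (m := ∞) (by simp)).differentiableAt (by simp)
    rw [fderiv_clm_apply hd (differentiableAt_const _),
      fderiv_clm_apply hd (differentiableAt_const _)]
    simpa using (hh z hz).isSymmSndFDerivAt (by simp [ENat.LEInfty.out]) (coordVec 0)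
      (coordVec 1)
  have h₀ := (hu 0).conj_mul hΩ (hpartial 1)
  have h₁ := (hu 1).conj_mul hΩ (hpartial 0)
  have hm := hΩ.measurableSet
  have hdiff (z) (hz : z ∈ Ω) := (hh z hz).differentiableAt (by simp)
  calc ∫ z in Ω, u z * wedge (dbarForm ψ) (dbarForm fun z => conj (h z)) z
      = ∫ z in Ω, (conj (fderiv ℂ h z (coordVec 1)) * u z * dbar 0 ψ z -
          conj (fderiv ℂ h z (coordVec 0)) * u z * dbar 1 ψ z) :=
        setIntegral_congr_fun hm fun z hz => by
          simp only [wedge, dbarForm_conj (hdiff z hz)]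
          simp only [dbarForm]
          ring
    _ = -∫ z in Ω, ((conj (fderiv ℂ h z (coordVec 1)) * α 0 z + _) * ψ z -
          (conj (fderiv ℂ h z (coordVec 0)) * α 1 z + _) * ψ z) := by
        rw [integral_sub ((hψ.dbar 0).integrableOn_mul hm h₀.1)
          ((hψ.dbar 1).integrableOn_mul hm h₁.1), h₀.2.2 ψ hψ, h₁.2.2 ψ hψ,
          integral_sub (hψ.integrableOn_mul hm h₀.2.1) (hψ.integrableOn_mul hm h₁.2.1)]
        ring
    _ = -∫ z in Ω, ψ z * wedge α (dbarForm fun z => conj (h z)) z :=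
        congrArg Neg.neg (setIntegral_congr_fun hm fun z hz => by
          simp only [wedge, dbarForm_conj (hdiff z hz), partial_comm z hz]
          ring)

theorem isWeakSolution_of_integral_mul_wedge (hu : LocallyIntegrableOn u Ω)
    (hα : ∀ j, LocallyIntegrableOn (α j) Ω)
    (H : ∀ h : ℂ × ℂ → ℂ, ContDiff ℂ ∞ h → ∀ ψ, IsTestFunction Ω ψ →
      ∫ z in Ω, u z * wedge (dbarForm ψ) (dbarForm fun z => conj (h z)) z =
        -∫ z in Ω, ψ z * wedge α (dbarForm fun z => conj (h z)) z) :
    IsWeakSolution Ω u α := by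
  have dbarForm_conj_fst (j : Fin 2) (z : ℂ × ℂ) :
      dbarForm (fun z => conj z.1) j z = conj (coordVec j).1 :=
    (dbarForm_conj differentiableAt_fst j).trans (by rw [fderiv_fst]; rfl)
  have dbarForm_conj_snd (j : Fin 2) (z : ℂ × ℂ) :
      dbarForm (fun z => conj z.2) j z = conj (coordVec j).2 :=
    (dbarForm_conj differentiableAt_snd j).trans (by rw [fderiv_snd]; rfl)
  refine Fin.forall_fin_two.2 ⟨⟨hu, hα 0, fun ψ hψ => ?_⟩, ⟨hu, hα 1, fun ψ hψ => ?_⟩⟩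
  · have key := H Prod.snd contDiff_snd ψ hψ
    simp only [wedge, dbarForm_conj_snd] at key
    simpa [coordVec, dbarForm, mul_comm] using key
  · have key := H Prod.fst contDiff_fst ψ hψ
    simp only [wedge, dbarForm_conj_fst] at key
    simpa [coordVec, dbarForm, mul_comm, integral_neg, neg_eq_iff_eq_neg] using key

end Forms

section Biholomorphism

variable {U V : Set (ℂ × ℂ)} {Φ Ψ : ℂ × ℂ → ℂ × ℂ} {ψ u : ℂ × ℂ → ℂ} {α : Form01} {w : ℂ × ℂ}

/-- `Φ : U → V` and `Ψ : V → U` are mutually inverse biholomorphisms of open sets. Both maps are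
total, and it is part of the notion that the preimages of `V` and `U` are exactly `U` and `V`, so
that composing with them carries functions supported in one set to functions supported in the
other. -/
structure IsBiholomorphism (Φ Ψ : ℂ × ℂ → ℂ × ℂ) (U V : Set (ℂ × ℂ)) : Prop where
  isOpen_source : IsOpen U
  isOpen_target : IsOpen V
  mem_target_iff : ∀ z, Φ z ∈ V ↔ z ∈ U
  mem_source_iff : ∀ w, Ψ w ∈ U ↔ w ∈ V
  left_inv : ∀ z ∈ U, Ψ (Φ z) = z
  right_inv : ∀ w ∈ V, Φ (Ψ w) = w
  contDiffAt : ∀ z ∈ U, ContDiffAt ℂ ∞ Φ z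
  contDiffAt_inv : ∀ w ∈ V, ContDiffAt ℂ ∞ Ψ w

instance isAddHaarMeasure_volume_prod : (volume : Measure (ℂ × ℂ)).IsAddHaarMeasure :=
  inferInstanceAs ((volume : Measure ℂ).prod volume).IsAddHaarMeasure

namespace IsBiholomorphism

protected theorem symm (h : IsBiholomorphism Φ Ψ U V) : IsBiholomorphism Ψ Φ V U :=
  ⟨h.2, h.1, h.4, h.3, h.6, h.5, h.8, h.7⟩

theorem differentiableAt (h : IsBiholomorphism Φ Ψ U V) {z : ℂ × ℂ} (hz : z ∈ U) :
    DifferentiableAt ℂ Φ z :=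
  (h.contDiffAt z hz).differentiableAt (by simp)

theorem hasFDerivWithinAt (h : IsBiholomorphism Φ Ψ U V) {z : ℂ × ℂ} (hz : z ∈ U)
    (s : Set (ℂ × ℂ)) : HasFDerivWithinAt Φ ((fderiv ℂ Φ z).restrictScalars ℝ) s z :=
  ((h.differentiableAt hz).hasFDerivAt.restrictScalars ℝ).hasFDerivWithinAt

theorem continuousOn (h : IsBiholomorphism Φ Ψ U V) : ContinuousOn Φ U :=
  fun z hz => (h.contDiffAt z hz).continuousAt.continuousWithinAt

theorem injOn (h : IsBiholomorphism Φ Ψ U V) : Set.InjOn Φ U :=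
  Set.LeftInvOn.injOn h.left_inv

theorem image_eq (h : IsBiholomorphism Φ Ψ U V) : Φ '' U = V :=
  Set.Subset.antisymm (Set.image_subset_iff.2 fun z hz => (h.mem_target_iff z).2 hz)
    fun w hw => ⟨Ψ w, (h.mem_source_iff w).2 hw, h.right_inv w hw⟩

theorem setIntegral_eq (h : IsBiholomorphism Φ Ψ U V) (F : ℂ × ℂ → ℂ) :
    ∫ z in U, F z = ∫ w in V, jacobian Ψ w * conj (jacobian Ψ w) * F (Ψ w) := by
  rw [← h.symm.image_eq, integral_image_eq_integral_abs_det_fderiv_smul volume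
    h.isOpen_target.measurableSet (fun w hw => h.symm.hasFDerivWithinAt hw V) h.symm.injOn]
  refine integral_congr_ae (.of_forall fun w => ?_)
  simp only [det_fderiv_restrictScalars]
  rw [abs_of_nonneg (normSq_nonneg _), real_smul, mul_conj]

theorem locallyIntegrableOn_comp (h : IsBiholomorphism Φ Ψ U V) (hu : LocallyIntegrableOn u V) :
    LocallyIntegrableOn (u ∘ Φ) U := by
  rw [locallyIntegrableOn_iff h.isOpen_source.isLocallyClosed]
  intro K hKU hK
  have hΦK : IsCompact (Φ '' K) := hK.image_of_continuousOn (h.continuousOn.mono hKU)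
  have hΦKV : Φ '' K ⊆ V := Set.image_subset_iff.2 fun z hz => (h.mem_target_iff z).2 (hKU hz)
  have hcont : ContinuousOn (fun w => normSq (jacobian Ψ w)) (Φ '' K) := fun w hw =>
    (continuous_normSq.continuousAt.comp
      (contDiffAt_jacobian (h.contDiffAt_inv w (hΦKV hw))).continuousAt).continuousWithinAt
  rw [← (Set.LeftInvOn.mono h.left_inv hKU).image_image,
    integrableOn_image_iff_integrableOn_abs_det_fderiv_smul volume hΦK.measurableSet
      (fun w hw => h.symm.hasFDerivWithinAt (hΦKV hw) _) (h.symm.injOn.mono hΦKV)]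
  refine ((hu.integrableOn_compact_subset hΦKV hΦK).continuousOn_smul hcont hΦK).congr_fun
    (fun w hw => ?_) hΦK.measurableSet
  simp only [det_fderiv_restrictScalars, abs_of_nonneg (normSq_nonneg _), Function.comp_apply,
    h.right_inv w (hΦKV hw)]

theorem locallyIntegrableOn_formPullback (h : IsBiholomorphism Φ Ψ U V)
    (hα : ∀ j, LocallyIntegrableOn (α j) V) (j : Fin 2) :
    LocallyIntegrableOn (formPullback Φ α j) U := by
  have hpartial : ContinuousOn (fun z => fderiv ℂ Φ z (coordVec j)) U := fun z hz =>
    (((h.contDiffAt z hz).fderiv_right (m := ∞) (by simp)).clm_apply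
      contDiffAt_const).continuousAt.continuousWithinAt
  exact ((h.locallyIntegrableOn_comp (hα 0)).continuousOn_mul
      (continuous_conj.comp_continuousOn hpartial.fst) h.isOpen_source.isLocallyClosed).add
    ((h.locallyIntegrableOn_comp (hα 1)).continuousOn_mul
      (continuous_conj.comp_continuousOn hpartial.snd) h.isOpen_source.isLocallyClosed)

theorem isTestFunction_jacobian_mul (h : IsBiholomorphism Φ Ψ U V) (hψ : IsTestFunction U ψ) :
    IsTestFunction V fun w => jacobian Ψ w * (ψ ∘ Ψ) w :=
  (hψ.comp (fun w hw => (h.contDiffAt_inv w hw).restrict_scalars ℝ) h.continuousOn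
    (fun z hz => (h.mem_target_iff z).2 hz)
    fun w hw => h.right_inv w ((h.mem_source_iff w).1 hw)).mul
    fun w hw => (contDiffAt_jacobian (h.contDiffAt_inv w hw)).restrict_scalars ℝ

theorem dbarForm_jacobian_mul (h : IsBiholomorphism Φ Ψ U V) (hψ : IsTestFunction U ψ)
    (hw : w ∈ V) (j : Fin 2) : dbarForm (fun w => jacobian Ψ w * (ψ ∘ Ψ) w) j w =
      jacobian Ψ w * formPullback Ψ (dbarForm ψ) j w := by
  have hΨ := h.symm.differentiableAt hw
  rw [dbarForm_mul_of_differentiableAt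
      ((contDiffAt_jacobian (h.contDiffAt_inv w hw)).differentiableAt (by simp))
      ((hψ.differentiableAt _).comp w (hΨ.restrictScalars ℝ)),
    formPullback_dbarForm (hψ.differentiableAt _) hΨ]

theorem formPullback_formPullback (h : IsBiholomorphism Φ Ψ U V) (hw : w ∈ V) (j : Fin 2) :
    formPullback Ψ (formPullback Φ α) j w = α j w := by
  have hev : Φ ∘ Ψ =ᶠ[nhds w] id :=
    Filter.eventuallyEq_of_mem (h.isOpen_target.mem_nhds hw) h.right_inv
  rw [formPullback_comp (h.differentiableAt ((h.mem_source_iff w).2 hw))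
    (h.symm.differentiableAt hw)]
  conv_rhs => rw [← formPullback_id α]
  simp only [formPullback, hev.fderiv_eq, hev.eq_of_nhds]

theorem setIntegral_comp_mul_wedge (h : IsBiholomorphism Φ Ψ U V) (u : ℂ × ℂ → ℂ)
    (α β : Form01) : ∫ z in U, u (Φ z) * wedge α β z =
      ∫ w in V, u w * (jacobian Ψ w * wedge (formPullback Ψ α) (formPullback Ψ β) w) := by
  rw [h.setIntegral_eq]
  refine setIntegral_congr_fun h.isOpen_target.measurableSet fun w hw => ?_
  simp only [wedge_formPullback, h.right_inv w hw]
  ring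

theorem isWeaklyDbarClosed_formPullback (h : IsBiholomorphism Φ Ψ U V)
    (hα : IsWeaklyDbarClosed V α) : IsWeaklyDbarClosed U (formPullback Φ α) := by
  rw [isWeaklyDbarClosed_iff h.isOpen_target.measurableSet] at hα
  refine (isWeaklyDbarClosed_iff h.isOpen_source.measurableSet).2
    ⟨h.locallyIntegrableOn_formPullback hα.1, fun ψ hψ => ?_⟩
  have transform := h.setIntegral_comp_mul_wedge 1 (formPullback Φ α) (dbarForm ψ)
  simp only [Pi.one_apply, one_mul] at transform
  rw [transform, ← hα.2 _ (h.isTestFunction_jacobian_mul hψ)]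
  refine setIntegral_congr_fun h.isOpen_target.measurableSet fun w hw => ?_
  simp only [wedge, h.formPullback_formPullback hw, h.dbarForm_jacobian_mul hψ hw]
  ring

theorem isWeakSolution_comp (h : IsBiholomorphism Φ Ψ U V) (hu : IsWeakSolution V u α) :
    IsWeakSolution U (u ∘ Φ) (formPullback Φ α) := by
  refine isWeakSolution_of_integral_mul_wedge (h.locallyIntegrableOn_comp (hu 0).1)
    (h.locallyIntegrableOn_formPullback fun j => (hu j).2.1) fun k hk ψ hψ => ?_
  set β := dbarForm fun z => conj (k z)
  set χ := fun w => jacobian Ψ w * (ψ ∘ Ψ) w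
  have pullback_β (w) (hw : w ∈ V) (j : Fin 2) :
      formPullback Ψ β j w = dbarForm (fun w => conj ((k ∘ Ψ) w)) j w :=
    formPullback_dbarForm (conjCLE.differentiableAt.comp _
      ((hk.differentiable (by simp) _).restrictScalars ℝ)) (h.symm.differentiableAt hw) j
  calc ∫ z in U, (u ∘ Φ) z * wedge (dbarForm ψ) β z
      = ∫ w in V, u w * wedge (dbarForm χ) (dbarForm fun w => conj ((k ∘ Ψ) w)) w := by
        refine (h.setIntegral_comp_mul_wedge u _ _).trans
          (setIntegral_congr_fun h.isOpen_target.measurableSet fun w hw => ?_)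
        simp only [wedge, pullback_β w hw, χ, h.dbarForm_jacobian_mul hψ hw]
        ring
    _ = -∫ w in V, χ w * wedge α (dbarForm fun w => conj ((k ∘ Ψ) w)) w :=
        hu.integral_mul_wedge h.isOpen_target
          (fun w hw => hk.contDiffAt.comp w (h.contDiffAt_inv w hw))
          (h.isTestFunction_jacobian_mul hψ)
    _ = -∫ w in V, (ψ ∘ Ψ) w *
          (jacobian Ψ w * wedge (formPullback Ψ (formPullback Φ α)) (formPullback Ψ β) w) :=
        congrArg Neg.neg (setIntegral_congr_fun h.isOpen_target.measurableSet fun w hw => by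
          simp only [wedge, pullback_β w hw, χ, h.formPullback_formPullback hw]
          ring)
    _ = -∫ z in U, ψ z * wedge (formPullback Φ α) β z := by
        rw [← h.setIntegral_comp_mul_wedge]
        exact congrArg Neg.neg (setIntegral_congr_fun h.isOpen_source.measurableSet fun z hz => by
          simp only [Function.comp_apply, h.left_inv z hz])

end IsBiholomorphism

end Biholomorphism

section LpEstimates

variable {X : Type*} [MeasurableSpace X] {μ : Measure X} {a h : X → ℂ} {p : ℝ≥0∞}

theorem memLp_mul_of_norm_le_one (ha : AEStronglyMeasurable a μ) (ha1 : ∀ᵐ x ∂μ, ‖a x‖ ≤ 1)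
    (hh : MemLp h p μ) : MemLp (fun x => a x * h x) p μ :=
  hh.of_le (ha.mul hh.1) (ha1.mono fun x hx => by
    rw [norm_mul]
    exact mul_le_of_le_one_left (norm_nonneg _) hx)

theorem eLpNorm_mul_le_of_norm_le_one (ha1 : ∀ᵐ x ∂μ, ‖a x‖ ≤ 1) (h : X → ℂ) :
    eLpNorm (fun x => a x * h x) p μ ≤ eLpNorm h p μ :=
  eLpNorm_mono_ae (ha1.mono fun x hx => by
    rw [norm_mul]
    exact mul_le_of_le_one_left (norm_nonneg _) hx)

theorem eLpNorm_mul_le_eLpNorm_withDensity (ha : Measurable a) (ha1 : ∀ᵐ x ∂μ, ‖a x‖ₑ ≤ 1)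
    (hp : 1 ≤ p) (h : X → ℂ) :
    eLpNorm (fun x => a x * h x) p μ ≤ eLpNorm h p (μ.withDensity fun x => ‖a x‖ₑ) := by
  rcases eq_or_ne p ⊤ with rfl | hp'
  · rw [eLpNorm_exponent_top, eLpNorm_exponent_top]
    have hbound := (ae_withDensity_iff ha.enorm).1
      (enorm_ae_le_eLpNormEssSup h (μ.withDensity fun x => ‖a x‖ₑ))
    refine eLpNormEssSup_le_of_ae_enorm_bound ?_
    filter_upwards [ha1, hbound] with x hax hx
    rcases eq_or_ne ‖a x‖ₑ 0 with h0 | h0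
    · simp [enorm_mul, h0]
    · rw [enorm_mul]
      exact mul_le_of_le_one_of_le hax (hx h0)
  · have hp0 : p ≠ 0 := (zero_lt_one.trans_le hp).ne'
    have hp1 : 1 ≤ p.toReal := by simpa using ENNReal.toReal_mono hp' hp
    rw [eLpNorm_eq_lintegral_rpow_enorm_toReal hp0 hp',
      eLpNorm_eq_lintegral_rpow_enorm_toReal hp0 hp',
      lintegral_withDensity_eq_lintegral_mul_non_measurable _ ha.enorm
        (.of_forall fun _ => enorm_lt_top)]
    refine ENNReal.rpow_le_rpow (lintegral_mono_ae ?_) (by positivity)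
    filter_upwards [ha1] with x hx
    rw [enorm_mul, ENNReal.mul_rpow_of_nonneg _ _ (by positivity), Pi.mul_apply]
    gcongr
    exact ENNReal.rpow_le_self_of_le_one hx hp1

theorem measurePreserving_of_ae_left_inverse {Y : Type*} [MeasurableSpace Y] {ν : Measure Y}
    {Φ : X → Y} {Ψ : Y → X} (hΦ : MeasurePreserving Φ μ ν) (hΨ : Measurable Ψ)
    (h : ∀ᵐ x ∂μ, Ψ (Φ x) = x) : MeasurePreserving Ψ ν μ := by
  refine ⟨hΨ, ?_⟩
  rw [← hΦ.map_eq, Measure.map_map hΨ hΦ.measurable]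
  exact (Measure.map_congr h).trans Measure.map_id

end LpEstimates

section Bidisc

theorem isOpen_disc : IsOpen disc := isOpen_lt continuous_norm continuous_const

theorem isOpen_puncDisc : IsOpen puncDisc :=
  (isOpen_lt continuous_const continuous_norm).inter isOpen_disc

theorem volume_disc_ne_top : volume disc ≠ ⊤ := by
  have : disc = Metric.ball 0 1 := by
    ext z
    simp [disc]
  rw [this]
  exact measure_ball_lt_top.ne

theorem volume_puncDisc_ne_top : volume puncDisc ≠ ⊤ :=
  measure_ne_top_of_subset (fun _ hz => hz.2) volume_disc_ne_top

instance isFiniteMeasure_restrict_disc_prod_puncDisc :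
    IsFiniteMeasure (volume.restrict (disc ×ˢ puncDisc) : Measure (ℂ × ℂ)) := by
  have := Fact.mk volume_disc_ne_top.lt_top
  have := Fact.mk volume_puncDisc_ne_top.lt_top
  rw [volume_restrict_prod]
  infer_instance

theorem ae_norm_le_one : ∀ᵐ w ∂(volume.restrict (disc ×ˢ puncDisc) : Measure (ℂ × ℂ)),
    ‖w.1‖ ≤ 1 ∧ ‖w.2‖ ≤ 1 :=
  ae_restrict_of_forall_mem (isOpen_disc.prod isOpen_puncDisc).measurableSet
    fun _ hw => ⟨le_of_lt hw.1, hw.2.2.le⟩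

variable {f : Form01} {p : ℝ≥0∞}

theorem exists_eLpNorm_T_le : ∃ C : ℝ≥0, ∀ p, 1 ≤ p → ∀ f, MemB (disc ×ˢ puncDisc) p f →
    eLpNorm (T f) p (volume.restrict (disc ×ˢ puncDisc)) ≤
      C * (∑ j, eLpNorm (f j) p (volume.restrict (disc ×ˢ puncDisc)) +
        eLpNorm (scriptD (disc ×ˢ puncDisc) f) p (volume.restrict (disc ×ˢ puncDisc))) := by
  obtain ⟨A, hK⟩ := exists_isSchurKernel_cauchyKernel volume_disc_ne_top
  obtain ⟨B, hL⟩ := exists_isSchurKernel_cauchyKernel volume_puncDisc_ne_top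
  refine ⟨B + A + A * B, fun p hp f hf => ?_⟩
  rw [← solOp_scriptD_eq_T, Fin.sum_univ_two]
  refine (eLpNorm_solOp_le hK hL (fun j => (hf.1 j).integrable hp) (hf.2.2.integrable hp)
    hp).trans ?_
  push_cast
  rw [add_mul, add_mul]
  gcongr
  · exact le_add_self.trans le_self_add
  · exact le_self_add.trans le_self_add
  · exact le_add_self

theorem MemB.memLp_T (hf : MemB (disc ×ˢ puncDisc) p f) (hp : 1 ≤ p) :
    MemLp (T f) p (volume.restrict (disc ×ˢ puncDisc)) := by
  obtain ⟨A, hK⟩ := exists_isSchurKernel_cauchyKernel volume_disc_ne_top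
  obtain ⟨B, hL⟩ := exists_isSchurKernel_cauchyKernel volume_puncDisc_ne_top
  have hmeas : AEStronglyMeasurable (T f) (volume.restrict (disc ×ˢ puncDisc)) := by
    rw [← solOp_scriptD_eq_T]
    exact (integrableOn_solOp hK hL (fun j => (hf.1 j).integrable hp)
      (hf.2.2.integrable hp)).aestronglyMeasurable
  obtain ⟨C, hC⟩ := exists_eLpNorm_T_le
  exact ⟨hmeas, (hC p hp f hf).trans_lt (ENNReal.mul_lt_top ENNReal.coe_lt_top
    (ENNReal.add_lt_top.2 ⟨ENNReal.sum_lt_top.2 fun j _ => (hf.1 j).2, hf.2.2.2⟩))⟩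

theorem MemB.ae_TConverges (hf : MemB (disc ×ˢ puncDisc) p f) (hp : 1 ≤ p) :
    ∀ᵐ w ∂(volume.restrict (disc ×ˢ puncDisc)), TConverges f w := by
  obtain ⟨A, hK⟩ := exists_isSchurKernel_cauchyKernel volume_disc_ne_top
  obtain ⟨B, hL⟩ := exists_isSchurKernel_cauchyKernel volume_puncDisc_ne_top
  have hfi (j : Fin 2) := (hf.1 j).integrable hp
  have hg := hf.2.2.integrable hp
  simp only [TConverges, IntegrableOn, volume_restrict_prod] at hfi hg ⊢
  filter_upwards [hL.ae_integrable_snd (hfi 1), hK.ae_integrable_fst (hfi 0),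
    hK.ae_integrable_prod hL hg] with w h₁ h₀ h₂
  simpa only [cauchyKernel, div_eq_mul_inv, mul_inv] using ⟨h₁, h₀, h₂⟩

theorem MemB.isWeakSolution_T (hf : MemB (disc ×ˢ puncDisc) p f) (hp : 1 ≤ p)
    (hclosed : IsWeaklyDbarClosed (disc ×ˢ puncDisc) f) :
    IsWeakSolution (disc ×ˢ puncDisc) (T f) f := by
  obtain ⟨A, hK⟩ := exists_isSchurKernel_cauchyKernel volume_disc_ne_top
  obtain ⟨B, hL⟩ := exists_isSchurKernel_cauchyKernel volume_puncDisc_ne_top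
  rw [← solOp_scriptD_eq_T]
  exact isWeakSolution_solOp hK hL (fun j => (hf.1 j).integrable hp) (hf.2.2.integrable hp)
    isOpen_disc isOpen_puncDisc (hf.2.1.hasWeakDbar_zero hclosed) (hf.2.1.hasWeakDbar_one hclosed)

end Bidisc

section Hartogs

theorem isOpen_hartogs : IsOpen hartogs :=
  (isOpen_lt continuous_fst.norm continuous_snd.norm).inter
    (isOpen_lt continuous_snd.norm continuous_const)

theorem norm_snd_pos {z : ℂ × ℂ} (hz : z ∈ hartogs) : 0 < ‖z.2‖ :=
  (norm_nonneg _).trans_lt hz.1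

theorem phi_mem_iff (z : ℂ × ℂ) : phi z ∈ disc ×ˢ puncDisc ↔ z ∈ hartogs := by
  simp only [phi, disc, puncDisc, hartogs, Set.mem_prod, Set.mem_ofPred_eq, norm_div]
  constructor
  · rintro ⟨h₁, h₂, h₃⟩
    exact ⟨(div_lt_one h₂).1 h₁, h₃⟩
  · rintro ⟨h₁, h₂⟩
    have h₃ := (norm_nonneg _).trans_lt h₁
    exact ⟨(div_lt_one h₃).2 h₁, h₃, h₂⟩

theorem phi_phiInv {w : ℂ × ℂ} (hw : w.2 ≠ 0) : phi (phiInv w) = w := by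
  simp [phiInv, phi, mul_div_cancel_right₀ _ hw]

theorem isBiholomorphism_phi : IsBiholomorphism phi phiInv hartogs (disc ×ˢ puncDisc) where
  isOpen_source := isOpen_hartogs
  isOpen_target := isOpen_disc.prod isOpen_puncDisc
  mem_target_iff := phi_mem_iff
  mem_source_iff w := by
    constructor <;> intro hw
    · have h₂ : w.2 ≠ 0 := norm_pos_iff.1 (norm_snd_pos (z := phiInv w) hw)
      rwa [← phi_mem_iff, phi_phiInv h₂] at hw
    · rwa [← phi_mem_iff, phi_phiInv (norm_pos_iff.1 hw.2.1)]
  left_inv z hz := by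
    simp [phiInv, phi, div_mul_cancel₀ _ (norm_pos_iff.1 (norm_snd_pos hz))]
  right_inv w hw := phi_phiInv (norm_pos_iff.1 hw.2.1)
  contDiffAt z hz :=
    (contDiffAt_fst.div contDiffAt_snd (norm_pos_iff.1 (norm_snd_pos hz))).prodMk contDiffAt_snd
  contDiffAt_inv _ _ := (contDiffAt_fst.mul contDiffAt_snd).prodMk contDiffAt_snd

theorem jacobian_phi {z : ℂ × ℂ} (hz : z.2 ≠ 0) : jacobian phi z = z.2⁻¹ := by
  have hinv : HasFDerivAt (fun z : ℂ × ℂ => z.2⁻¹) _ z :=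
    (hasFDerivAt_inv hz).comp z hasFDerivAt_snd
  have hphi : HasFDerivAt phi _ z := (hasFDerivAt_fst.mul hinv).prodMk hasFDerivAt_snd
  simp [jacobian, hphi.fderiv, coordVec]

theorem pullback_eq_formPullback (α : Form01) : pullback α = formPullback phiInv α := by
  funext j w
  have hmul : HasFDerivAt (fun w : ℂ × ℂ => w.1 * w.2) _ w :=
    hasFDerivAt_fst.mul (𝕜 := ℂ) hasFDerivAt_snd
  have hphiInv : HasFDerivAt phiInv _ w := hmul.prodMk hasFDerivAt_snd
  fin_cases j <;> simp [pullback, formPullback, hphiInv.fderiv, coordVec]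

theorem measurable_weight (s : ℝ) : Measurable fun z : ℂ × ℂ => ENNReal.ofReal (‖z.2‖ ^ s) :=
  (measurable_snd.norm.pow_const s).ennreal_ofReal

theorem weighted_absolutelyContinuous (s t : ℝ) : weighted s ≪ weighted t :=
  (withDensity_absolutelyContinuous _ _).trans <|
    withDensity_absolutelyContinuous' (measurable_weight t).aemeasurable <|
      ae_restrict_of_forall_mem isOpen_hartogs.measurableSet fun _ hz =>
        (ENNReal.ofReal_pos.2 (Real.rpow_pos_of_pos (norm_snd_pos hz) t)).ne'

theorem restrict_hartogs_le_weighted {s : ℝ} (hs : s ≤ 0) :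
    volume.restrict hartogs ≤ weighted s := by
  rw [weighted]
  conv_lhs => rw [← withDensity_one (μ := volume.restrict hartogs)]
  refine withDensity_mono (ae_restrict_of_forall_mem isOpen_hartogs.measurableSet fun z hz => ?_)
  exact ENNReal.one_le_ofReal.2
    (Real.one_le_rpow_of_pos_of_le_one_of_nonpos (norm_snd_pos hz) hz.2.le hs)

theorem weighted_add_one (s : ℝ) :
    weighted (s + 1) = (weighted s).withDensity fun z => ‖conj z.2‖ₑ := by
  have hm : Measurable fun z : ℂ × ℂ => ‖conj z.2‖ₑ :=
    (continuous_conj.comp continuous_snd).measurable.enorm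
  rw [weighted, weighted, ← withDensity_mul _ (measurable_weight s) hm]
  refine withDensity_congr_ae (ae_restrict_of_forall_mem isOpen_hartogs.measurableSet
    fun z hz => ?_)
  simp only [Pi.mul_apply]
  rw [← ofReal_norm, norm_conj, ← ENNReal.ofReal_mul (by positivity),
    Real.rpow_add_one (norm_snd_pos hz).ne']

theorem measurePreserving_phi :
    MeasurePreserving phi (weighted (-2)) (volume.restrict (disc ×ˢ puncDisc)) := by
  refine ⟨(measurable_fst.div measurable_snd).prodMk measurable_snd, ?_⟩
  have h := isBiholomorphism_phi
  rw [← h.image_eq, ← map_withDensity_abs_det_fderiv_eq_addHaar volume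
    h.isOpen_source.measurableSet.nullMeasurableSet (fun z hz => h.hasFDerivWithinAt hz _) h.injOn]
  refine congrArg _ (withDensity_congr_ae
    (ae_restrict_of_forall_mem isOpen_hartogs.measurableSet fun z hz => ?_))
  have hz2 := norm_snd_pos hz
  simp only [det_fderiv_restrictScalars, jacobian_phi (norm_pos_iff.1 hz2), normSq_eq_norm_sq,
    norm_inv]
  rw [abs_of_nonneg (by positivity), Real.rpow_neg hz2.le, inv_pow]
  norm_num

theorem measurePreserving_phiInv :
    MeasurePreserving phiInv (volume.restrict (disc ×ˢ puncDisc)) (weighted (-2)) :=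
  measurePreserving_of_ae_left_inverse measurePreserving_phi
    ((measurable_fst.mul measurable_snd).prodMk measurable_snd)
    ((withDensity_absolutelyContinuous _ _).ae_le
      (ae_restrict_of_forall_mem isOpen_hartogs.measurableSet isBiholomorphism_phi.left_inv))

end Hartogs

section Pullback

variable {p : ℝ≥0∞} {α : Form01} {dα₁ : Fin 2 → ℂ × ℂ → ℂ} {h u : ℂ × ℂ → ℂ}

theorem memLp_comp_phi (hu : MemLp u p (volume.restrict (disc ×ˢ puncDisc))) :
    MemLp (u ∘ phi) p (volume.restrict hartogs) :=
  (hu.comp_measurePreserving measurePreserving_phi).mono_measure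
    (restrict_hartogs_le_weighted (by norm_num))

theorem eLpNorm_comp_phi_le
    (hu : AEStronglyMeasurable u (volume.restrict (disc ×ˢ puncDisc))) :
    eLpNorm (u ∘ phi) p (volume.restrict hartogs) ≤
      eLpNorm u p (volume.restrict (disc ×ˢ puncDisc)) :=
  (eLpNorm_mono_measure _ (restrict_hartogs_le_weighted (by norm_num))).trans_eq
    (eLpNorm_comp_measurePreserving hu measurePreserving_phi)

theorem eLpNorm_conj_snd_mul_le (hp : 1 ≤ p) (h : ℂ × ℂ → ℂ) :
    eLpNorm (fun z => conj z.2 * h z) p (weighted (-2)) ≤ eLpNorm h p (weighted (-1)) := by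
  have hle : ∀ᵐ z ∂weighted (-2), ‖conj z.2‖ₑ ≤ 1 :=
    (withDensity_absolutelyContinuous _ _).ae_le
      (ae_restrict_of_forall_mem isOpen_hartogs.measurableSet fun z hz => by
        rw [← ofReal_norm, norm_conj]
        exact ENNReal.ofReal_le_one.2 hz.2.le)
  rw [show (-1 : ℝ) = -2 + 1 by norm_num, weighted_add_one]
  exact eLpNorm_mul_le_eLpNorm_withDensity (continuous_conj.comp continuous_snd).measurable hle hp h

theorem memLp_conj_snd_mul (hp : 1 ≤ p) (hh : MemLp h p (weighted (-1))) :
    MemLp (fun z => conj z.2 * h z) p (weighted (-2)) :=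
  ⟨(continuous_conj.comp continuous_snd).aestronglyMeasurable.mul
    (hh.1.mono_ac (weighted_absolutelyContinuous _ _)),
    (eLpNorm_conj_snd_mul_le hp h).trans_lt hh.2⟩

theorem memLp_pullback (hα : ∀ j, MemLp (α j) p (weighted (-2))) (j : Fin 2) :
    MemLp (pullback α j) p (volume.restrict (disc ×ˢ puncDisc)) := by
  have hcomp (j : Fin 2) := (hα j).comp_measurePreserving measurePreserving_phiInv
  fin_cases j
  · exact memLp_mul_of_norm_le_one (continuous_conj.comp continuous_snd).aestronglyMeasurable
      (ae_norm_le_one.mono fun w hw => (norm_conj _).trans_le hw.2) (hcomp 0)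
  · exact (memLp_mul_of_norm_le_one (continuous_conj.comp continuous_fst).aestronglyMeasurable
      (ae_norm_le_one.mono fun w hw => (norm_conj _).trans_le hw.1) (hcomp 0)).add (hcomp 1)

theorem eLpNorm_pullback_le (hp : 1 ≤ p) (hα : ∀ j, MemLp (α j) p (weighted (-2))) (j : Fin 2) :
    eLpNorm (pullback α j) p (volume.restrict (disc ×ˢ puncDisc)) ≤
      ∑ j, eLpNorm (α j) p (weighted (-2)) := by
  have hcomp (j : Fin 2) :=
    eLpNorm_comp_measurePreserving (p := p) (hα j).1 measurePreserving_phiInv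
  have hmeas (j : Fin 2) := (hα j).1.comp_measurePreserving measurePreserving_phiInv
  rw [Fin.sum_univ_two, ← hcomp, ← hcomp]
  fin_cases j
  · exact (eLpNorm_mul_le_of_norm_le_one
      (ae_norm_le_one.mono fun w hw => (norm_conj _).trans_le hw.2) _).trans le_self_add
  · refine (eLpNorm_add_le ((continuous_conj.comp continuous_fst).aestronglyMeasurable.mul
      (hmeas 0)) (hmeas 1) hp).trans (add_le_add_left (eLpNorm_mul_le_of_norm_le_one
      (ae_norm_le_one.mono fun w hw => (norm_conj _).trans_le hw.1) _) _)

/-- The function `∂f₁/∂w̄₂` representing `𝒟f` for a `∂̄`-closed `α` with pull-back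
`f = (φ⁻¹)^*α`, where `dα₁ j` is the derivative of `α₁ = α 0` in the `j`-th variable. -/
def pullbackD (α : Form01) (dα₁ : Fin 2 → ℂ × ℂ → ℂ) (w : ℂ × ℂ) : ℂ :=
  pullback (fun j z => conj z.2 * dα₁ j z) 1 w + α 0 (phiInv w)

theorem memLp_pullbackD (hp : 1 ≤ p) (hα : ∀ j, MemLp (α j) p (weighted (-2)))
    (hdα : ∀ j, MemLp (dα₁ j) p (weighted (-1))) :
    MemLp (pullbackD α dα₁) p (volume.restrict (disc ×ˢ puncDisc)) :=
  (memLp_pullback (fun j => memLp_conj_snd_mul hp (hdα j)) 1).add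
    ((hα 0).comp_measurePreserving measurePreserving_phiInv)

theorem eLpNorm_pullbackD_le (hp : 1 ≤ p) (hα : ∀ j, MemLp (α j) p (weighted (-2)))
    (hdα : ∀ j, MemLp (dα₁ j) p (weighted (-1))) :
    eLpNorm (pullbackD α dα₁) p (volume.restrict (disc ×ˢ puncDisc)) ≤
      ∑ j, eLpNorm (α j) p (weighted (-2)) + ∑ j, eLpNorm (dα₁ j) p (weighted (-1)) := by
  have hβ (j : Fin 2) := memLp_conj_snd_mul hp (hdα j)
  rw [add_comm]
  refine (eLpNorm_add_le (memLp_pullback hβ 1).1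
    ((hα 0).comp_measurePreserving measurePreserving_phiInv).1 hp).trans (add_le_add ?_ ?_)
  · exact (eLpNorm_pullback_le hp hβ 1).trans
      (Finset.sum_le_sum fun j _ => eLpNorm_conj_snd_mul_le hp (dα₁ j))
  · exact (eLpNorm_comp_measurePreserving (hα 0).1 measurePreserving_phiInv).trans_le
      (Finset.single_le_sum (f := fun j => eLpNorm (α j) p (weighted (-2)))
        (fun _ _ => zero_le) (Finset.mem_univ 0))

theorem isWeaklyDbarClosed_pullback (hα : IsWeaklyDbarClosed hartogs α) :
    IsWeaklyDbarClosed (disc ×ˢ puncDisc) (pullback α) := by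
  rw [pullback_eq_formPullback]
  exact isBiholomorphism_phi.symm.isWeaklyDbarClosed_formPullback hα

theorem isScriptD_pullbackD (hα : IsWeaklyDbarClosed hartogs α)
    (hdα : ∀ j, HasWeakDbar hartogs j (α 0) (dα₁ j)) :
    IsScriptD (disc ×ˢ puncDisc) (pullback α) (pullbackD α dα₁) := by
  have hcomp : IsWeakSolution (disc ×ˢ puncDisc) (α 0 ∘ phiInv) (pullback dα₁) := by
    rw [pullback_eq_formPullback]
    exact isBiholomorphism_phi.symm.isWeakSolution_comp hdα
  have hmul := (hcomp 1).conj_mul (isOpen_disc.prod isOpen_puncDisc)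
    fun _ _ => (contDiffAt_snd (𝕜 := ℂ))
  refine (isWeaklyDbarClosed_pullback hα).isScriptD (hmul.congr_right (.of_forall fun w => ?_))
  have hsnd : fderiv ℂ Prod.snd w (coordVec 1) = 1 := by simp [fderiv_snd, coordVec]
  simp only [pullbackD, pullback, Matrix.cons_val_one, Matrix.cons_val_fin_one,
    Function.comp_apply, phiInv, hsnd, map_one]
  ring

theorem isWeakSolution_comp_phi (hu : IsWeakSolution (disc ×ˢ puncDisc) u (pullback α)) :
    IsWeakSolution hartogs (u ∘ phi) α := fun j => by
  rw [pullback_eq_formPullback] at hu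
  exact (isBiholomorphism_phi.isWeakSolution_comp hu j).congr_right
    (ae_restrict_of_forall_mem isOpen_hartogs.measurableSet fun z hz =>
      isBiholomorphism_phi.symm.formPullback_formPullback hz j)

theorem scriptD_pullback_ae_eq (hα : IsWeaklyDbarClosed hartogs α)
    (hdα : ∀ j, HasWeakDbar hartogs j (α 0) (dα₁ j)) :
    scriptD (disc ×ˢ puncDisc) (pullback α) =ᵐ[volume.restrict (disc ×ˢ puncDisc)]
      pullbackD α dα₁ :=
  have hD := isScriptD_pullbackD hα hdα
  hD.isScriptD_scriptD.ae_eq (isOpen_disc.prod isOpen_puncDisc) hD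

theorem memB_pullback (hp : 1 ≤ p) (hα : IsWeaklyDbarClosed hartogs α)
    (hdα : ∀ j, HasWeakDbar hartogs j (α 0) (dα₁ j))
    (hαp : ∀ j, MemLp (α j) p (weighted (-2))) (hdαp : ∀ j, MemLp (dα₁ j) p (weighted (-1))) :
    MemB (disc ×ˢ puncDisc) p (pullback α) :=
  ⟨memLp_pullback hαp, (isScriptD_pullbackD hα hdα).isScriptD_scriptD,
    (memLp_pullbackD hp hαp hdαp).ae_eq (scriptD_pullback_ae_eq hα hdα).symm⟩

theorem exists_eLpNorm_T_pullback_le : ∃ C : ℝ≥0, 0 < C ∧ ∀ p, 1 ≤ p →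
    ∀ (α : Form01) (dα₁ : Fin 2 → ℂ × ℂ → ℂ), IsWeaklyDbarClosed hartogs α →
      (∀ j, MemLp (α j) p (weighted (-2))) → (∀ j, HasWeakDbar hartogs j (α 0) (dα₁ j)) →
      (∀ j, MemLp (dα₁ j) p (weighted (-1))) →
      eLpNorm (T (pullback α)) p (volume.restrict (disc ×ˢ puncDisc)) ≤
        C * (∑ j, eLpNorm (α j) p (weighted (-2)) +
          ∑ j, eLpNorm (dα₁ j) p (weighted (-1))) := by
  obtain ⟨C, hC⟩ := exists_eLpNorm_T_le
  refine ⟨C * 3 + 1, by positivity, fun p hp α dα₁ hα hαp hdα hdαp => ?_⟩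
  set N := ∑ j, eLpNorm (α j) p (weighted (-2)) + ∑ j, eLpNorm (dα₁ j) p (weighted (-1))
  have hf (j : Fin 2) :
      eLpNorm (pullback α j) p (volume.restrict (disc ×ˢ puncDisc)) ≤ N :=
    (eLpNorm_pullback_le hp hαp j).trans le_self_add
  have hD : eLpNorm (scriptD (disc ×ˢ puncDisc) (pullback α)) p
      (volume.restrict (disc ×ˢ puncDisc)) ≤ N :=
    (eLpNorm_congr_ae (scriptD_pullback_ae_eq hα hdα)).trans_le (eLpNorm_pullbackD_le hp hαp hdαp)
  calc eLpNorm (T (pullback α)) p (volume.restrict (disc ×ˢ puncDisc))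
      ≤ C * (N + N + N) := by
        refine (hC p hp _ (memB_pullback hp hα hdα hαp hdαp)).trans ?_
        rw [Fin.sum_univ_two]
        exact mul_le_mul_right (add_le_add (add_le_add (hf 0) (hf 1)) hD) _
    _ = C * 3 * N := by ring
    _ ≤ ↑(C * 3 + 1) * N := by
        push_cast
        gcongr
        exact le_self_add

end Pullback

end HartogsDbar

open HartogsDbar

theorem theorem5p1_general :
    ∃ C : ℝ≥0, 0 < C ∧ ∀ p : ℝ≥0∞, 1 ≤ p →
      ∀ (α : Form01) (dα₁ : Fin 2 → ℂ × ℂ → ℂ), IsWeaklyDbarClosed hartogs α →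
        (∀ j, MemLp (α j) p (weighted (-2))) →
        (∀ j, HasWeakDbar hartogs j (α 0) (dα₁ j)) →
        (∀ j, MemLp (dα₁ j) p (weighted (-1))) →
        MemB (disc ×ˢ puncDisc) p (pullback α) ∧
        (∀ᵐ w ∂(volume.restrict (disc ×ˢ puncDisc)), TConverges (pullback α) w) ∧
        IsWeakSolution hartogs (T (pullback α) ∘ phi) α ∧
        MemLp (T (pullback α) ∘ phi) p (volume.restrict hartogs) ∧
        eLpNorm (T (pullback α) ∘ phi) p (volume.restrict hartogs) ≤
          C * (∑ j, eLpNorm (α j) p (weighted (-2)) +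
            ∑ j, eLpNorm (dα₁ j) p (weighted (-1))) := by
  obtain ⟨C, hC, hbound⟩ := exists_eLpNorm_T_pullback_le
  refine ⟨C, hC, fun p hp α dα₁ hα hαp hdα hdαp => ?_⟩
  have hB := memB_pullback hp hα hdα hαp hdαp
  have hsol := hB.isWeakSolution_T hp (isWeaklyDbarClosed_pullback hα)
  have hT := hB.memLp_T hp
  exact ⟨hB, hB.ae_TConverges hp, isWeakSolution_comp_phi hsol, memLp_comp_phi hT,
    (eLpNorm_comp_phi_le hT.1).trans (hbound p hp α dα₁ hα hαp hdα hdαp)⟩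

theorem theorem5p1 (p : ℝ≥0∞) (hp_one : 1 ≤ p) (hp_top : p ≠ ⊤) :
    ∃ C : ℝ≥0, 0 < C ∧
      ∀ (α : HartogsDbar.Form01) (dα₁ : Fin 2 → ℂ × ℂ → ℂ),
        HartogsDbar.IsWeaklyDbarClosed HartogsDbar.hartogs α →
        (∀ j, MemLp (α j) p (HartogsDbar.weighted (-2))) →
        -- `dα₁ j` is the weak derivative of `α₁` with respect to the conjugate of the `j`-th variable
        (∀ j, HartogsDbar.HasWeakDbar HartogsDbar.hartogs j (α 0) (dα₁ j)) →
        (∀ j, MemLp (dα₁ j) p (HartogsDbar.weighted (-1))) →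
        HartogsDbar.MemB (HartogsDbar.disc ×ˢ HartogsDbar.puncDisc) p (HartogsDbar.pullback α) ∧
        (∀ᵐ w ∂(volume.restrict (HartogsDbar.disc ×ˢ HartogsDbar.puncDisc)),
          HartogsDbar.TConverges (HartogsDbar.pullback α) w) ∧
        HartogsDbar.IsWeakSolution HartogsDbar.hartogs
          (HartogsDbar.T (HartogsDbar.pullback α) ∘ HartogsDbar.phi) α ∧
        MemLp (HartogsDbar.T (HartogsDbar.pullback α) ∘ HartogsDbar.phi) p
          (volume.restrict HartogsDbar.hartogs) ∧
        eLpNorm (HartogsDbar.T (HartogsDbar.pullback α) ∘ HartogsDbar.phi) p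
            (volume.restrict HartogsDbar.hartogs)
          ≤ C * (∑ j, eLpNorm (α j) p (HartogsDbar.weighted (-2))
                + ∑ j, eLpNorm (dα₁ j) p (HartogsDbar.weighted (-1))) := by
  obtain ⟨C, hC, h⟩ := theorem5p1_general
  exact ⟨C, hC, h p hp_one⟩
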